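/- Let $\omega=e^{2i\pi/3}$ and let $G_{25}\subset \mathrm{GL}_3(\mathbb{C})$ be the group generated by the three reflections of order $3$ $$R_1=\begin{pmatrix}1&0&0\\0&1&0\\0&0&\omega^2\end{pmatrix},\quad R_2=\frac{\omega^2-\omega}{3}\begin{pmatrix}\omega&\omega^2&\omega^2\\ \omega^2&\omega&\omega^2\\ \omega^2&\omega^2&\omega\end{pmatrix},\quad R_3=\begin{pmatrix}1&0&0\\0&\omega^2&0\\0&0&1\end{pmatrix}.$$ It acts on the set $\mathbb{P}^2(\mathbb{C})$ of complex lines of $\mathbb{C}^3$. A *reflection plane* of $G_{25}$ is a plane of $\mathbb{C}^3$ fixed pointwise by a nontrivial element of $G_{25}$; a vector is *regular* if it lies on no reflection plane; a *proper plane* is an eigenspace $\ker(g-\zeta)$, with $g\in G_{25}$ and $\zeta\in\mathbb{C}^*$ of order $6$, that contains a regular vector. Every orbit of lines under $G_{25}$ is of exactly one of the following eight types, where the columns give the size of the orbit, the number of orbits of that type, and the numbers of reflection planes and of proper planes on which each line of the orbit lies. | Size | Number of orbits | Reflection planes | Proper planes | |---|---|---|---| | 216 | generic | 0 | 0 | |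 72 | 1 | 0 | 0 | | 108 | infinite, of dimension 1 | 0 | 1 | | 54 | 1 | 0 | 1 | | 72 | infinite, of dimension 1 | 1 | 0 | | 36 | 1 | 1 | 1 | | 12 | 1 | 2 | 3 | | 9 | 1 | 4 | 0 | Here $\mathbb{P}^2(\mathbb{C})/G_{25}$ carries the quotient of the Zariski topology; "generic" means that the orbits of this type form a dense open subset of $\mathbb{P}^2(\mathbb{C})/G_{25}$, and "infinite, of dimension 1" that they form an infinite subset whose Krull dimension (in the induced topology) is $1$. Moreover, - for every $\nu\in\mathbb{C}^*$ of order $9$, the line $[\nu:\nu^2:1]$ represents the only orbit of size $72$ whose lines lie on no reflection plane; - the line $[(1+\sqrt3)\,\omega^2:\omega:1]$ represents the only orbit of size $54$; - for two lines, neither of which lies in the orbit of $[\nu:\nu^2:1]$ ($\nu$ of order $9$) or of $[(1+\sqrt3)\,\omega^2:\omega:1]$, the orbits have the same size if and only if the two lines lie on the same number of reflection planes and on the same number of proper planes. -/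

import Mathlib

open scoped LinearAlgebra.Projectivization MatrixGroups

noncomputable section

namespace Hessian

/-- The cube root of unity `ω = exp(2πi/3)`. -/
def ω : ℂ := Complex.exp (2 * Real.pi * Complex.I / 3)

theorem omega_pow_three : ω ^ 3 = 1 := by
  rw [ω, ← Complex.exp_nat_mul, Complex.exp_eq_one_iff]
  exact ⟨1, by push_cast; ring⟩

theorem omega_sq : ω ^ 2 = -1 - ω := by
  have h1 : ω ≠ 1 := by
    rw [ω, Ne, Complex.exp_eq_one_iff]
    rintro ⟨n, hn⟩
    have h3 : (3 * n : ℂ) = 1 := by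
      have := Complex.two_pi_I_ne_zero
      field_simp at hn
      linear_combination -hn
    have h4 : 3 * n = 1 := by exact_mod_cast h3
    omega
  have h : (ω - 1) * (ω ^ 2 + ω + 1) = 0 := by linear_combination omega_pow_three
  rcases mul_eq_zero.mp h with h | h
  · exact absurd (sub_eq_zero.mp h) h1
  · linear_combination h

/-- The matrix of the generator `R₁`. -/
def M₁ : Matrix (Fin 3) (Fin 3) ℂ := !![1, 0, 0; 0, 1, 0; 0, 0, ω ^ 2]

/-- The matrix of the generator `R₂`. -/
def M₂ : Matrix (Fin 3) (Fin 3) ℂ :=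
  ((ω ^ 2 - ω) / 3) • !![ω, ω ^ 2, ω ^ 2; ω ^ 2, ω, ω ^ 2; ω ^ 2, ω ^ 2, ω]

/-- The matrix of the generator `R₃`. -/
def M₃ : Matrix (Fin 3) (Fin 3) ℂ := !![1, 0, 0; 0, ω ^ 2, 0; 0, 0, 1]

theorem M₁_pow_three : M₁ ^ 3 = 1 := by
  have h : ω ^ 2 * ω ^ 2 * ω ^ 2 = 1 := by
    linear_combination (ω ^ 3 + 1) * omega_pow_three
  ext i j
  fin_cases i <;> fin_cases j <;>
    simp [M₁, pow_succ, Matrix.mul_apply, Fin.sum_univ_three]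
  linear_combination h

theorem M₃_pow_three : M₃ ^ 3 = 1 := by
  have h : ω ^ 2 * ω ^ 2 * ω ^ 2 = 1 := by
    linear_combination (ω ^ 3 + 1) * omega_pow_three
  ext i j
  fin_cases i <;> fin_cases j <;>
    simp [M₃, pow_succ, Matrix.mul_apply, Fin.sum_univ_three]
  linear_combination h

theorem M₂_pow_three : M₂ ^ 3 = 1 := by
  have key : M₂ =
      (1 / 3 : ℂ) • !![ω + 2, ω - 1, ω - 1; ω - 1, ω + 2, ω - 1; ω - 1, ω - 1, ω + 2] := by
    ext i j
    fin_cases i <;> fin_cases j <;> simp [M₂] <;> grind [omega_sq]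
  rw [key]
  ext i j
  fin_cases i <;> fin_cases j <;>
    simp [pow_succ, Matrix.mul_apply, Fin.sum_univ_three] <;> grind [omega_sq]

/-- The reflection `R₁` as an element of `GL₃(ℂ)`. -/
def R₁ : GL (Fin 3) ℂ := Units.ofPowEqOne M₁ 3 M₁_pow_three (by norm_num)

/-- The reflection `R₂` as an element of `GL₃(ℂ)`. -/
def R₂ : GL (Fin 3) ℂ := Units.ofPowEqOne M₂ 3 M₂_pow_three (by norm_num)

/-- The reflection `R₃` as an element of `GL₃(ℂ)`. -/
def R₃ : GL (Fin 3) ℂ := Units.ofPowEqOne M₃ 3 M₃_pow_three (by norm_num)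

/-- The group `G₂₅`, generated by the three reflections `R₁`, `R₂`, `R₃`. -/
def G25 : Subgroup (GL (Fin 3) ℂ) := Subgroup.closure {R₁, R₂, R₃}

/-- A point of `ℙ²(ℂ)`, that is, a complex line (through the origin) of `ℂ³`. The group `GL₃(ℂ)`,
hence also `G25`, acts on these lines through `g • v = g *ᵥ v`. -/
abbrev Line : Type := ℙ ℂ (Fin 3 → ℂ)

/-- The line `[a : b : 1]`. -/
def line (a b : ℂ) : Line :=
  Projectivization.mk ℂ ![a, b, 1] (fun h => one_ne_zero (congrFun h 2))

/-- `P` is a reflection plane of `G25`: a plane that is fixed pointwise by a nontrivial element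
of the group (such an element is a complex reflection). -/
def IsReflectionPlane (P : Submodule ℂ (Fin 3 → ℂ)) : Prop :=
  Module.finrank ℂ P = 2 ∧ ∃ g ∈ G25, g ≠ 1 ∧ ∀ v ∈ P, g • v = v

/-- A regular vector lies on no reflection plane. -/
def IsRegularVector (v : Fin 3 → ℂ) : Prop :=
  ∀ P : Submodule ℂ (Fin 3 → ℂ), IsReflectionPlane P → v ∉ P

/-- The eigenspace `V(g, ζ)`. -/
def eigenspace (g : GL (Fin 3) ℂ) (ζ : ℂ) : Submodule ℂ (Fin 3 → ℂ) :=
  Module.End.eigenspace (Matrix.toLin' (g : Matrix (Fin 3) (Fin 3) ℂ)) ζ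

/-- `E` is a proper plane: a regular eigenspace (one that contains a regular vector) of an element
of `G25` for an eigenvalue of order `6`. -/
def IsProperPlane (E : Submodule ℂ (Fin 3 → ℂ)) : Prop :=
  ∃ g ∈ G25, ∃ ζ : ℂ, orderOf ζ = 6 ∧ E = eigenspace g ζ ∧ ∃ v ∈ E, IsRegularVector v

/-- The number of reflection planes on which the line `L` lies. -/
def numReflectionPlanes (L : Line) : ℕ∞ :=
  {P : Submodule ℂ (Fin 3 → ℂ) | IsReflectionPlane P ∧ L.submodule ≤ P}.encard

/-- The number of proper planes on which the line `L` lies. -/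
def numProperPlanes (L : Line) : ℕ∞ :=
  {E : Submodule ℂ (Fin 3 → ℂ) | IsProperPlane E ∧ L.submodule ≤ E}.encard

/-- The Zariski topology on `ℙ²(ℂ)`, generated by the complements of the zero loci of homogeneous
polynomials. -/
instance zariskiTopology : TopologicalSpace Line :=
  TopologicalSpace.generateFrom
    {U | ∃ (d : ℕ) (F : MvPolynomial (Fin 3) ℂ), F.IsHomogeneous d ∧
      U = {L : Line | ∃ v ∈ L.submodule, MvPolynomial.eval v F ≠ 0}}

/-- The set of orbits of `G25` on lines, that is `ℙ²(ℂ) / G25`. It carries the quotient of the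
Zariski topology. -/
abbrev LineOrbit : Type := MulAction.orbitRel.Quotient G25 Line

/-- The orbit of the line `L`, as a point of `ℙ²(ℂ) / G25`. -/
def orbitOf (L : Line) : LineOrbit := Quotient.mk'' L

/-- The orbits of `n` lines, each of which lies on exactly `r` reflection planes and exactly `p`
proper planes. -/
def orbitsOfType (n r p : ℕ∞) : Set LineOrbit :=
  {O | O.orbit.encard = n ∧
    ∀ L ∈ O.orbit, numReflectionPlanes L = r ∧ numProperPlanes L = p}

/-- A set of orbits that is infinite of dimension one: Krull dimension with respect to
the topology induced from `ℙ²(ℂ) / G25`. -/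
def IsInfiniteOfDimOne (S : Set LineOrbit) : Prop :=
  S.Infinite ∧ topologicalKrullDim S = 1

/-- A set of orbits that consists of the generic ones: a dense Zariski open subset of
`ℙ²(ℂ) / G25`. -/
def IsGeneric (S : Set LineOrbit) : Prop :=
  IsOpen S ∧ Dense S

end Hessian

end

/-
Index the coordinates of `ℂ³` by the field `F₃` and let `χ a = ωᵃ` be its additive character. Then
`G25` is the image of `F₃² ⋊ SL₂(F₃)` under the Weil representation, extended by the scalars: its
648 elements are the monomial matrices `v ↦ (i ↦ ± χ(a i² + b i + c) v (± i + t))` and the Gaussian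
matrices with entries `± χ(a i² ± i j + b j² + c i + d j + e) / √-3`, and quadratic Gauss sums give
their multiplication table. Whether such a matrix fixes a line is then decided by a few equations
between cube roots of unity, so that stabilizers can be counted.

A matrix with `a + b = 0` in the Gaussian family has a monomial square, and the others are conjugate
to monomial matrices. Hence a line with a nonscalar stabilizer is in the orbit of `[0 : x : 1]` (on
a reflection plane), of `[x : 1 : 1]` (on the proper plane that a coordinate swap negates) or of
`[ν : ν² : 1]` with `ν` of order 9 (an eigenvector of a monomial 3-cycle). The orbits of the first
two kinds are governed by `x³`; the exceptional ones among them are those with `x³ ∈ {0, 1, -1}`,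
and `x³ ∈ {0, 1, -8}` or `x⁶ - 20 x³ - 8 = 0`.
-/

noncomputable section

namespace Hessian

open Matrix
open scoped Fin.CommRing Pointwise

theorem isPrimitiveRoot_ω : IsPrimitiveRoot ω 3 := by
  have h := Complex.isPrimitiveRoot_exp 3 three_ne_zero
  simpa only [ω, Nat.cast_ofNat] using h

/-- The additive character `a ↦ ω ^ a` of the field with three elements. The type `Fin 3` is used
both for this field and for the indices of the coordinates of `ℂ³`. -/
def χ : AddChar (Fin 3) ℂ := AddChar.zmodChar 3 omega_pow_three

theorem χ_apply (a : Fin 3) : χ a = ω ^ (a : ℕ) := AddChar.zmodChar_apply omega_pow_three a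

theorem χ_zero : χ 0 = 1 := χ.map_zero_eq_one

theorem χ_add (a b : Fin 3) : χ (a + b) = χ a * χ b := χ.map_add_eq_mul a b

theorem χ_one : χ 1 = ω := by rw [χ_apply, Fin.val_one, pow_one]

theorem χ_two : χ 2 = ω ^ 2 := χ_apply 2

theorem χ_pow_three (a : Fin 3) : χ a ^ 3 = 1 := by
  rw [χ_apply, pow_right_comm, omega_pow_three, one_pow]

theorem χ_ne_zero (a : Fin 3) : χ a ≠ 0 := fun h => by
  simpa [h] using χ_pow_three a

theorem χ_injective : Function.Injective χ := fun a b h => by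
  rw [χ_apply, χ_apply] at h
  exact Fin.ext (isPrimitiveRoot_ω.pow_inj a.isLt b.isLt h)

theorem χ_eq_one_iff {a : Fin 3} : χ a = 1 ↔ a = 0 := by
  rw [← χ_zero, χ_injective.eq_iff]

theorem exists_χ_eq {x : ℂ} (hx : x ^ 3 = 1) : ∃ a, χ a = x := by
  obtain ⟨n, hn, rfl⟩ := isPrimitiveRoot_ω.eq_pow_of_pow_eq_one hx
  exact ⟨⟨n, hn⟩, χ_apply _⟩

theorem exists_eq_χ_mul_of_pow_three_eq {x y : ℂ} (hy : y ≠ 0) (h : x ^ 3 = y ^ 3) :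
    ∃ a, x = χ a * y := by
  obtain ⟨a, ha⟩ := exists_χ_eq (x := x / y) (by rw [div_pow, h, div_self (pow_ne_zero 3 hy)])
  exact ⟨a, by rw [ha, div_mul_cancel₀ x hy]⟩

theorem sum_χ_mul (l : Fin 3) : ∑ j, χ (l * j) = if l = 0 then 3 else 0 := by
  have h := AddChar.sum_mulShift (R := Fin 3) l
    (AddChar.zmodChar_primitive_of_primitive_root 3 isPrimitiveRoot_ω)
  simp only [mul_comm l, χ]
  rw [h]
  split_ifs <;> simp

/-- The quadratic Gauss sum `∑ χ(j²)`, that is `√3 i`. -/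
def gaussSum : ℂ := ω - ω ^ 2

theorem gaussSum_sq : gaussSum ^ 2 = -3 := by
  grind [gaussSum, omega_sq]

theorem gaussSum_ne_zero : gaussSum ≠ 0 := fun h => by
  simpa [h] using gaussSum_sq

/-- The reduction of a sign modulo `3`. -/
def modThree (s : ℤˣ) : Fin 3 := ((s : ℤ) : Fin 3)

theorem modThree_one : modThree 1 = 1 := rfl

theorem modThree_mul_self (s : ℤˣ) : modThree s * modThree s = 1 := by decide +revert

theorem modThree_mul (s s' : ℤˣ) : modThree (s * s') = modThree s * modThree s' := by
  decide +revert

theorem modThree_neg (s : ℤˣ) : modThree (-s) = -modThree s := by decide +revert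

theorem exists_modThree_eq {m : Fin 3} (hm : m ≠ 0) : ∃ s, modThree s = m := by decide +revert

theorem sum_χ_sq (s : ℤˣ) : ∑ j, χ (modThree s * (j * j)) = s * gaussSum := by
  rcases Int.units_eq_one_or s with rfl | rfl <;>
    norm_num [Fin.sum_univ_three, modThree, gaussSum, χ_apply] <;> grind [omega_sq]

theorem three_eq_zero : (3 : Fin 3) = 0 := rfl

theorem sum_χ_quadratic (s : ℤˣ) (l : Fin 3) :
    ∑ j, χ (modThree s * (j * j) + l * j) = s * gaussSum * χ (-(modThree s * (l * l))) := by
  have completeSquare (j : Fin 3) : χ (modThree s * ((j + modThree s * l) * (j + modThree s * l)) +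
      l * (j + modThree s * l)) = χ (modThree s * (j * j)) * χ (-(modThree s * (l * l))) := by
    rw [← χ_add]
    congr 1
    linear_combination (2 * j * l + modThree s * l * l) * modThree_mul_self s +
      (j * l + modThree s * l * l) * three_eq_zero
  rw [← Equiv.sum_comp (Equiv.addRight (modThree s * l))]
  simp only [Equiv.coe_addRight, completeSquare]
  rw [← Finset.sum_mul, sum_χ_sq]

/-- The monomial matrix with the entries `s χ(a i² + b i + c)` in the positions `(i, s i + t)`.
The matrices of this kind form the normalizer in `G₂₅` of its diagonal subgroup. -/
def monomialMatrix (s : ℤˣ) (t a b c : Fin 3) : Matrix (Fin 3) (Fin 3) ℂ :=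
  of fun i j => if j = modThree s * i + t then s * χ (a * (i * i) + b * i + c) else 0

/-- The matrix with the entries `s χ(a i² + s i j + b j² + c i + d j + e) / (√3 i)`, that is, a
discrete Fourier transform composed with multiplications by quadratic phases. -/
def gaussianMatrix (s : ℤˣ) (a b c d e : Fin 3) : Matrix (Fin 3) (Fin 3) ℂ :=
  of fun i j => s * gaussSum⁻¹ *
    χ (a * (i * i) + modThree s * (i * j) + b * (j * j) + c * i + d * j + e)

theorem monomialMatrix_mulVec (s : ℤˣ) (t a b c : Fin 3) (v : Fin 3 → ℂ) (i : Fin 3) :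
    (monomialMatrix s t a b c *ᵥ v) i =
      s * χ (a * (i * i) + b * i + c) * v (modThree s * i + t) := by
  simp [monomialMatrix, mulVec, dotProduct]

theorem gaussianMatrix_mulVec (s : ℤˣ) (a b c d e : Fin 3) (v : Fin 3 → ℂ) (i : Fin 3) :
    (gaussianMatrix s a b c d e *ᵥ v) i = s * gaussSum⁻¹ * χ (a * (i * i) + c * i + e) *
      ∑ j, χ (b * (j * j) + (modThree s * i + d) * j) * v j := by
  simp only [gaussianMatrix, mulVec, dotProduct, of_apply, Finset.mul_sum]
  refine Finset.sum_congr rfl fun j _ => ?_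
  rw [← mul_assoc (_ * χ _), mul_assoc _ (χ _) (χ _), ← χ_add]
  ring_nf

theorem monomialMatrix_mul_apply (s : ℤˣ) (t a b c : Fin 3) (A : Matrix (Fin 3) (Fin 3) ℂ)
    (i k : Fin 3) : (monomialMatrix s t a b c * A) i k =
      s * χ (a * (i * i) + b * i + c) * A (modThree s * i + t) k :=
  monomialMatrix_mulVec s t a b c (fun j => A j k) i

theorem one_eq_monomialMatrix : (1 : Matrix (Fin 3) (Fin 3) ℂ) = monomialMatrix 1 0 0 0 0 := by
  ext i j
  simp [monomialMatrix, modThree, one_apply, eq_comm]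

theorem monomialMatrix_mul_monomialMatrix (s s' : ℤˣ) (t a b c t' a' b' c' : Fin 3) :
    monomialMatrix s t a b c * monomialMatrix s' t' a' b' c' =
      monomialMatrix (s * s') (modThree s' * t + t') (a + a')
        (b + 2 * a' * modThree s * t + b' * modThree s) (c + a' * (t * t) + b' * t + c') := by
  ext i k
  rw [monomialMatrix_mul_apply]
  simp only [monomialMatrix, of_apply, mul_ite, mul_zero]
  refine if_ctx_congr ?_ (fun _ => ?_) (fun _ => rfl)
  · rw [modThree_mul]
    ring_nf
  · rw [mul_mul_mul_comm, ← χ_add, Units.val_mul, Int.cast_mul]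
    congr 2
    linear_combination a' * (i * i) * modThree_mul_self s

theorem monomialMatrix_mul_gaussianMatrix (s s' : ℤˣ) (t a b c a' b' c' d' e' : Fin 3) :
    monomialMatrix s t a b c * gaussianMatrix s' a' b' c' d' e' =
      gaussianMatrix (s * s') (a + a') b' (b + 2 * a' * modThree s * t + c' * modThree s)
        (d' + modThree s' * t) (c + a' * (t * t) + c' * t + e') := by
  ext i k
  rw [monomialMatrix_mul_apply]
  simp only [gaussianMatrix, of_apply]
  rw [mul_mul_mul_comm, ← χ_add, Units.val_mul, Int.cast_mul, modThree_mul, ← mul_assoc]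
  congr 2
  linear_combination a' * (i * i) * modThree_mul_self s

theorem gaussianMatrix_mul_monomialMatrix (s s' : ℤˣ) (a b c d e t' a' b' c' : Fin 3) :
    gaussianMatrix s a b c d e * monomialMatrix s' t' a' b' c' =
      gaussianMatrix (s * s') a (b + a') (c - modThree (s * s') * t')
        ((b + a') * t' + (d + b') * modThree s')
        (e + c' + (b + a') * (t' * t') - (d + b') * modThree s' * t') := by
  ext i k
  have preimage (j : Fin 3) : k = modThree s' * j + t' ↔ j = modThree s' * (k - t') := by
    constructor <;> rintro rfl
    · linear_combination -j * modThree_mul_self s'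
    · linear_combination (t' - k) * modThree_mul_self s'
  simp only [mul_apply, monomialMatrix, gaussianMatrix, of_apply, preimage, mul_ite, mul_zero,
    Finset.sum_ite_eq', Finset.mem_univ, if_true]
  rw [mul_mul_mul_comm, ← χ_add, Units.val_mul, Int.cast_mul, modThree_mul,
    mul_right_comm (s : ℂ) _ (s' : ℂ)]
  congr 2
  linear_combination (b + a') * ((k - t') * (k - t')) * modThree_mul_self s' -
    (b + a') * k * t' * three_eq_zero

theorem gaussianMatrix_mul_apply (s s' : ℤˣ) (a b c d e a' b' c' d' e' i k : Fin 3) :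
    (gaussianMatrix s a b c d e * gaussianMatrix s' a' b' c' d' e') i k =
      s * s' * (gaussSum⁻¹ * gaussSum⁻¹) *
        χ (a * (i * i) + b' * (k * k) + c * i + d' * k + (e + e')) *
        ∑ j, χ ((b + a') * (j * j) + (modThree s * i + modThree s' * k + (d + c')) * j) := by
  simp only [mul_apply, gaussianMatrix, of_apply, Finset.mul_sum]
  refine Finset.sum_congr rfl fun j _ => ?_
  rw [mul_mul_mul_comm, ← χ_add, mul_mul_mul_comm, mul_assoc _ (χ _) (χ _), ← χ_add]
  ring_nf

theorem gaussianMatrix_mul_gaussianMatrix_of_add_eq_zero (s s' : ℤˣ)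
    (a b c d e a' b' c' d' e' : Fin 3) (h : b + a' = 0) :
    gaussianMatrix s a b c d e * gaussianMatrix s' a' b' c' d' e' =
      monomialMatrix (-(s * s')) (-(modThree s' * (d + c'))) (a + b')
        (c + 2 * b' * modThree s * (d + c') - d' * modThree (s * s'))
        (e + e' + b' * ((d + c') * (d + c')) - d' * modThree s' * (d + c')) := by
  ext i k
  have vanishing : modThree s * i + modThree s' * k + (d + c') = 0 ↔
      k = modThree (-(s * s')) * i + -(modThree s' * (d + c')) := by
    rw [modThree_neg, modThree_mul]
    constructor <;> intro hk
    · linear_combination modThree s' * hk - k * modThree_mul_self s'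
    · linear_combination modThree s' * hk - (modThree s * i + (d + c')) * modThree_mul_self s'
  rw [gaussianMatrix_mul_apply, h]
  simp only [zero_mul, zero_add, sum_χ_mul, vanishing, mul_ite, mul_zero, monomialMatrix, of_apply]
  refine if_ctx_congr Iff.rfl (fun hk => ?_) (fun _ => rfl)
  have gaussSum_inv_sq : gaussSum⁻¹ * gaussSum⁻¹ * 3 = -1 := by
    rw [← mul_inv, ← sq, gaussSum_sq]
    norm_num
  rw [mul_right_comm, mul_assoc (_ * _) (_ * _) (3 : ℂ), gaussSum_inv_sq, mul_neg_one,
    Units.val_neg, Int.cast_neg, Units.val_mul, Int.cast_mul]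
  congr 2
  rw [hk, modThree_neg, modThree_mul]
  linear_combination
    b' * ((modThree s * i + (d + c')) * (modThree s * i + (d + c'))) * modThree_mul_self s' +
      b' * (i * i) * modThree_mul_self s

theorem gaussianMatrix_mul_gaussianMatrix_of_add_eq (s s' σ : ℤˣ)
    (a b c d e a' b' c' d' e' : Fin 3) (h : b + a' = modThree σ) :
    gaussianMatrix s a b c d e * gaussianMatrix s' a' b' c' d' e' =
      gaussianMatrix (s * s' * σ) (a - modThree σ) (b' - modThree σ)
        (c + modThree (s * σ) * (d + c')) (d' + modThree (s' * σ) * (d + c'))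
        (e + e' - modThree σ * ((d + c') * (d + c'))) := by
  ext i k
  rw [gaussianMatrix_mul_apply, h, sum_χ_quadratic]
  simp only [gaussianMatrix, of_apply]
  have cancel : (s : ℂ) * s' * (gaussSum⁻¹ * gaussSum⁻¹) * (σ * gaussSum) =
      s * s' * σ * gaussSum⁻¹ := by
    field_simp [gaussSum_ne_zero]
  rw [mul_mul_mul_comm, ← χ_add, cancel]
  push_cast
  congr 2
  simp only [modThree_mul]
  linear_combination -modThree σ * (i * i) * modThree_mul_self s -
    modThree σ * (k * k) * modThree_mul_self s' - modThree σ * (modThree s * modThree s' * i * k +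
      modThree s * i * (d + c') + modThree s' * k * (d + c')) * three_eq_zero

/-- The monoid of the matrices of the elements of `G₂₅`, see `coe_mem_hessianMonoid` and
`exists_mem_G25_coe_eq`. -/
def hessianMonoid : Submonoid (Matrix (Fin 3) (Fin 3) ℂ) where
  carrier := {A | (∃ s t a b c, A = monomialMatrix s t a b c) ∨
    ∃ s a b c d e, A = gaussianMatrix s a b c d e}
  one_mem' := Or.inl ⟨1, 0, 0, 0, 0, one_eq_monomialMatrix⟩
  mul_mem' := by
    rintro _ _ (⟨s, t, a, b, c, rfl⟩ | ⟨s, a, b, c, d, e, rfl⟩)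
      (⟨s', t', a', b', c', rfl⟩ | ⟨s', a', b', c', d', e', rfl⟩)
    · exact Or.inl ⟨_, _, _, _, _, monomialMatrix_mul_monomialMatrix ..⟩
    · exact Or.inr ⟨_, _, _, _, _, _, monomialMatrix_mul_gaussianMatrix ..⟩
    · exact Or.inr ⟨_, _, _, _, _, _, gaussianMatrix_mul_monomialMatrix ..⟩
    · by_cases h : b + a' = 0
      · exact Or.inl ⟨_, _, _, _, _, gaussianMatrix_mul_gaussianMatrix_of_add_eq_zero (h := h) ..⟩
      · obtain ⟨σ, hσ⟩ := exists_modThree_eq h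
        exact Or.inr ⟨_, _, _, _, _, _,
          gaussianMatrix_mul_gaussianMatrix_of_add_eq (h := hσ.symm) ..⟩

theorem mem_hessianMonoid_iff {A : Matrix (Fin 3) (Fin 3) ℂ} : A ∈ hessianMonoid ↔
    (∃ s t a b c, A = monomialMatrix s t a b c) ∨ ∃ s a b c d e, A = gaussianMatrix s a b c d e :=
  Iff.rfl

theorem monomialMatrix_mem_hessianMonoid (s : ℤˣ) (t a b c : Fin 3) :
    monomialMatrix s t a b c ∈ hessianMonoid :=
  Or.inl ⟨s, t, a, b, c, rfl⟩

theorem gaussianMatrix_mem_hessianMonoid (s : ℤˣ) (a b c d e : Fin 3) :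
    gaussianMatrix s a b c d e ∈ hessianMonoid :=
  Or.inr ⟨s, a, b, c, d, e, rfl⟩

theorem M₁_eq_monomialMatrix : M₁ = monomialMatrix 1 0 1 2 0 := by
  ext i j
  fin_cases i <;> fin_cases j <;> simp [M₁, monomialMatrix, modThree, χ_apply]

theorem M₃_eq_monomialMatrix : M₃ = monomialMatrix 1 0 1 1 0 := by
  ext i j
  fin_cases i <;> fin_cases j <;> simp [M₃, monomialMatrix, modThree, χ_apply]

theorem M₂_eq_gaussianMatrix : M₂ = gaussianMatrix 1 1 1 0 0 1 := by
  have h : (ω ^ 2 - ω) / 3 = gaussSum⁻¹ := by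
    refine eq_inv_of_mul_eq_one_left ?_
    grind [gaussSum, omega_sq]
  ext i j
  fin_cases i <;> fin_cases j <;> simp [M₂, h, gaussianMatrix, modThree, χ_apply]

section Generation

variable {S : Submonoid (Matrix (Fin 3) (Fin 3) ℂ)}

theorem diagonal_mem_of_generators_mem (h₁ : M₁ ∈ S) (h₃ : M₃ ∈ S) (a b : Fin 3) :
    monomialMatrix 1 0 a b 0 ∈ S := by
  have powers_M₁ : ∀ x : Fin 3, monomialMatrix 1 0 x (2 * x) 0 ∈ S
    | 0 => one_eq_monomialMatrix ▸ S.one_mem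
    | 1 => M₁_eq_monomialMatrix ▸ h₁
    | 2 => by
      have h := S.mul_mem h₁ h₁
      rwa [M₁_eq_monomialMatrix, monomialMatrix_mul_monomialMatrix] at h
  have powers_M₃ : ∀ x : Fin 3, monomialMatrix 1 0 x x 0 ∈ S
    | 0 => one_eq_monomialMatrix ▸ S.one_mem
    | 1 => M₃_eq_monomialMatrix ▸ h₃
    | 2 => by
      have h := S.mul_mem h₃ h₃
      rwa [M₃_eq_monomialMatrix, monomialMatrix_mul_monomialMatrix] at h
  have h := S.mul_mem (powers_M₁ (b - a)) (powers_M₃ (2 * a - b))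
  rw [monomialMatrix_mul_monomialMatrix] at h
  convert h using 2 <;> (clear * -; decide +revert)

theorem gaussianMatrix_one_mem_of_generators_mem (h₁ : M₁ ∈ S) (h₂ : M₂ ∈ S) (h₃ : M₃ ∈ S)
    (a b c d : Fin 3) : gaussianMatrix 1 a b c d 1 ∈ S := by
  have h := S.mul_mem (S.mul_mem (diagonal_mem_of_generators_mem h₁ h₃ (a - 1) c) h₂)
    (diagonal_mem_of_generators_mem h₁ h₃ (b - 1) d)
  rw [M₂_eq_gaussianMatrix, monomialMatrix_mul_gaussianMatrix,
    gaussianMatrix_mul_monomialMatrix] at h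
  convert h using 1; simp [modThree]

theorem scalar_mem_of_generators_mem (h₁ : M₁ ∈ S) (h₂ : M₂ ∈ S) (h₃ : M₃ ∈ S) :
    ∀ c : Fin 3, monomialMatrix 1 0 0 0 c ∈ S := by
  have h := gaussianMatrix_one_mem_of_generators_mem h₁ h₂ h₃ 0 0 0 0
  have hsq := S.mul_mem h h
  rw [gaussianMatrix_mul_gaussianMatrix_of_add_eq_zero (h := rfl)] at hsq
  have scalar_one := S.mul_mem hsq hsq
  rw [monomialMatrix_mul_monomialMatrix] at scalar_one
  have scalar_two := S.mul_mem scalar_one scalar_one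
  rw [monomialMatrix_mul_monomialMatrix] at scalar_two
  exact fun | 0 => one_eq_monomialMatrix ▸ S.one_mem | 1 => scalar_one | 2 => scalar_two

theorem gaussianMatrix_mem_of_generators_mem (h₁ : M₁ ∈ S) (h₂ : M₂ ∈ S) (h₃ : M₃ ∈ S)
    (s : ℤˣ) (a b c d e : Fin 3) : gaussianMatrix s a b c d e ∈ S := by
  have positive (a b c d e : Fin 3) : gaussianMatrix 1 a b c d e ∈ S := by
    have h := S.mul_mem (scalar_mem_of_generators_mem h₁ h₂ h₃ (e - 1))
      (gaussianMatrix_one_mem_of_generators_mem h₁ h₂ h₃ a b c d)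
    rw [monomialMatrix_mul_gaussianMatrix] at h
    convert h using 1; simp [modThree]
  obtain rfl | rfl := Int.units_eq_one_or s
  · exact positive a b c d e
  · have h := S.mul_mem (positive (a - 1) (-1) c 0 e) (positive 0 (b - 1) 0 d 0)
    rw [gaussianMatrix_mul_gaussianMatrix_of_add_eq (σ := -1) (h := rfl)] at h
    convert h using 1; simp [modThree]

theorem hessianMonoid_le_of_generators_mem (h₁ : M₁ ∈ S) (h₂ : M₂ ∈ S) (h₃ : M₃ ∈ S) :
    hessianMonoid ≤ S := by
  rintro _ (⟨s, t, a, b, c, rfl⟩ | ⟨s, a, b, c, d, e, rfl⟩)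
  · have h := S.mul_mem (gaussianMatrix_mem_of_generators_mem h₁ h₂ h₃ (-s) a 0 b 0 c)
      (gaussianMatrix_mem_of_generators_mem h₁ h₂ h₃ 1 0 0 (-t) 0 0)
    rw [gaussianMatrix_mul_gaussianMatrix_of_add_eq_zero (h := rfl)] at h
    convert h using 1; simp [modThree]
  · exact gaussianMatrix_mem_of_generators_mem h₁ h₂ h₃ s a b c d e

end Generation

theorem coe_mem_hessianMonoid {g : GL (Fin 3) ℂ} (hg : g ∈ G25) :
    (g : Matrix (Fin 3) (Fin 3) ℂ) ∈ hessianMonoid := by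
  have generators : ∀ x ∈ ({R₁, R₂, R₃} : Set (GL (Fin 3) ℂ)),
      (x : Matrix (Fin 3) (Fin 3) ℂ) ∈ hessianMonoid ∧ x ^ 3 = 1 := by
    rintro x (rfl | rfl | rfl)
    · refine ⟨?_, Units.ext M₁_pow_three⟩
      change M₁ ∈ hessianMonoid
      exact M₁_eq_monomialMatrix ▸ monomialMatrix_mem_hessianMonoid 1 0 1 2 0
    · refine ⟨?_, Units.ext M₂_pow_three⟩
      change M₂ ∈ hessianMonoid
      exact M₂_eq_gaussianMatrix ▸ gaussianMatrix_mem_hessianMonoid 1 1 1 0 0 1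
    · refine ⟨?_, Units.ext M₃_pow_three⟩
      change M₃ ∈ hessianMonoid
      exact M₃_eq_monomialMatrix ▸ monomialMatrix_mem_hessianMonoid 1 0 1 1 0
  induction hg using Subgroup.closure_induction_left with
  | one => exact hessianMonoid.one_mem
  | mul_left x hx y _ hy => exact hessianMonoid.mul_mem (generators x hx).1 hy
  | inv_mul_cancel x hx y _ hy =>
    rw [inv_eq_of_mul_eq_one_left ((pow_succ x 2).symm.trans (generators x hx).2)]
    exact hessianMonoid.mul_mem (hessianMonoid.pow_mem (generators x hx).1 2) hy

theorem exists_mem_G25_coe_eq {A : Matrix (Fin 3) (Fin 3) ℂ} (hA : A ∈ hessianMonoid) :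
    ∃ g ∈ G25, (g : Matrix (Fin 3) (Fin 3) ℂ) = A := by
  have generator_mem {g : GL (Fin 3) ℂ} (hg : g ∈ ({R₁, R₂, R₃} : Set (GL (Fin 3) ℂ))) :
      (g : Matrix (Fin 3) (Fin 3) ℂ) ∈ G25.toSubmonoid.map (Units.coeHom _) :=
    ⟨g, Subgroup.subset_closure hg, rfl⟩
  exact hessianMonoid_le_of_generators_mem (generator_mem (g := R₁) (by simp))
    (generator_mem (g := R₂) (by simp)) (generator_mem (g := R₃) (by simp)) hA

theorem sign_mul_χ_inj {s s' : ℤˣ} {x y : Fin 3} (h : (s : ℂ) * χ x = s' * χ y) :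
    s = s' ∧ x = y := by
  have h_cube : (s : ℂ) ^ 3 = s' ^ 3 := by
    rw [← mul_one ((s : ℂ) ^ 3), ← χ_pow_three x, ← mul_pow, h, mul_pow, χ_pow_three, mul_one]
  have h_sign : s = s' := by
    obtain rfl | rfl := Int.units_eq_one_or s <;> obtain rfl | rfl := Int.units_eq_one_or s' <;>
      first | rfl | norm_num at h_cube
  subst h_sign
  exact ⟨rfl, χ_injective (mul_left_cancel₀ (by simp) h)⟩

theorem eq_of_forall_quadratic_eq {a b c a' b' c' : Fin 3}
    (h : ∀ i, a * (i * i) + b * i + c = a' * (i * i) + b' * i + c') : a = a' ∧ b = b' ∧ c = c' := by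
  have vanishing (a b c : Fin 3) (h : ∀ i, a * (i * i) + b * i + c = 0) :
      a = 0 ∧ b = 0 ∧ c = 0 := by decide +revert
  simpa only [sub_eq_zero] using vanishing (a - a') (b - b') (c - c') fun i => by
    linear_combination h i

theorem monomialMatrix_inj {s s' : ℤˣ} {t a b c t' a' b' c' : Fin 3}
    (h : monomialMatrix s t a b c = monomialMatrix s' t' a' b' c') :
    s = s' ∧ t = t' ∧ a = a' ∧ b = b' ∧ c = c' := by
  have key (i : Fin 3) : modThree s * i + t = modThree s' * i + t' ∧ s = s' ∧
      a * (i * i) + b * i + c = a' * (i * i) + b' * i + c' := by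
    have entry := congrFun (congrFun h i) (modThree s * i + t)
    simp only [monomialMatrix, of_apply, if_true] at entry
    split_ifs at entry with hi
    · exact ⟨hi, sign_mul_χ_inj entry⟩
    · simp [χ_ne_zero] at entry
  exact ⟨(key 0).2.1, by simpa using (key 0).1, eq_of_forall_quadratic_eq fun i => (key i).2.2⟩

theorem gaussianMatrix_inj {s s' : ℤˣ} {a b c d e a' b' c' d' e' : Fin 3}
    (h : gaussianMatrix s a b c d e = gaussianMatrix s' a' b' c' d' e') :
    s = s' ∧ a = a' ∧ b = b' ∧ c = c' ∧ d = d' ∧ e = e' := by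
  have key (i j : Fin 3) := sign_mul_χ_inj (mul_left_cancel₀ (inv_ne_zero gaussSum_ne_zero) (by
    simpa only [gaussianMatrix, of_apply, mul_left_comm, mul_assoc] using
      congrFun (congrFun h i) j))
  obtain rfl := (key 0 0).1
  obtain ⟨ha, hc, he⟩ := eq_of_forall_quadratic_eq fun i => by simpa using (key i 0).2
  obtain ⟨hb, hd, -⟩ := eq_of_forall_quadratic_eq fun j => by simpa using (key 0 j).2
  exact ⟨rfl, ha, hb, hc, hd, he⟩

theorem monomialMatrix_ne_gaussianMatrix {s s' : ℤˣ} {t a b c a' b' c' d' e' : Fin 3} :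
    monomialMatrix s t a b c ≠ gaussianMatrix s' a' b' c' d' e' := fun h => by
  simpa [monomialMatrix, gaussianMatrix, gaussSum_ne_zero, χ_ne_zero] using
    congrFun (congrFun h 0) (t + 1)

/-- The parameters of the elements of `G₂₅` up to scalars: `(s, t, a, b)` for `monomialMatrix` and
`(s, a, b, c, d)` for `gaussianMatrix`. -/
abbrev ProjectiveIndex : Type :=
  (ℤˣ × Fin 3 × Fin 3 × Fin 3) ⊕ (ℤˣ × Fin 3 × Fin 3 × Fin 3 × Fin 3)

/-- The parametrization of the elements of `G₂₅`; the second argument determines the scalar. -/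
def indexMatrix : ProjectiveIndex → Fin 3 → Matrix (Fin 3) (Fin 3) ℂ
  | .inl (s, t, a, b), c => monomialMatrix s t a b c
  | .inr (s, a, b, c, d), e => gaussianMatrix s a b c d e

theorem indexMatrix_mem_hessianMonoid : ∀ p c, indexMatrix p c ∈ hessianMonoid
  | .inl _, _ => monomialMatrix_mem_hessianMonoid ..
  | .inr _, _ => gaussianMatrix_mem_hessianMonoid ..

theorem exists_indexMatrix_eq {A : Matrix (Fin 3) (Fin 3) ℂ} (hA : A ∈ hessianMonoid) :
    ∃ p c, indexMatrix p c = A := by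
  obtain ⟨s, t, a, b, c, rfl⟩ | ⟨s, a, b, c, d, e, rfl⟩ := hA
  · exact ⟨.inl (s, t, a, b), c, rfl⟩
  · exact ⟨.inr (s, a, b, c, d), e, rfl⟩

theorem indexMatrix_injective : Function.Injective2 indexMatrix := by
  rintro (⟨s, t, a, b⟩ | ⟨s, a, b, c, d⟩) (⟨s', t', a', b'⟩ | ⟨s', a', b', c', d'⟩) e e' h
  · obtain ⟨rfl, rfl, rfl, rfl, rfl⟩ := monomialMatrix_inj h
    exact ⟨rfl, rfl⟩
  · exact absurd h monomialMatrix_ne_gaussianMatrix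
  · exact absurd h.symm monomialMatrix_ne_gaussianMatrix
  · obtain ⟨rfl, rfl, rfl, rfl, rfl, rfl⟩ := gaussianMatrix_inj h
    exact ⟨rfl, rfl⟩

/-- The element of `G₂₅` with the given parameters. -/
def ofIndex (x : ProjectiveIndex × Fin 3) : G25 :=
  have h := exists_mem_G25_coe_eq (indexMatrix_mem_hessianMonoid x.1 x.2)
  ⟨h.choose, h.choose_spec.1⟩

theorem coe_ofIndex (x : ProjectiveIndex × Fin 3) :
    ((ofIndex x : GL (Fin 3) ℂ) : Matrix (Fin 3) (Fin 3) ℂ) = indexMatrix x.1 x.2 :=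
  (exists_mem_G25_coe_eq (indexMatrix_mem_hessianMonoid x.1 x.2)).choose_spec.2

theorem ofIndex_bijective : Function.Bijective ofIndex := by
  refine ⟨fun x y h => ?_, fun g => ?_⟩
  · have hxy := congrArg (fun g : G25 => ((g : GL (Fin 3) ℂ) : Matrix (Fin 3) (Fin 3) ℂ)) h
    simp only [coe_ofIndex] at hxy
    exact Prod.ext_iff.mpr (indexMatrix_injective hxy)
  · obtain ⟨p, c, h⟩ := exists_indexMatrix_eq (coe_mem_hessianMonoid g.2)
    exact ⟨(p, c), Subtype.ext (Units.ext ((coe_ofIndex (p, c)).trans h))⟩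

instance finite_G25 : Finite G25 := Finite.of_surjective ofIndex ofIndex_bijective.surjective

theorem card_G25 : Nat.card G25 = 648 := by
  rw [← Nat.card_eq_of_bijective ofIndex ofIndex_bijective, Nat.card_eq_fintype_card]
  simp

/-- The matrix `A` maps the line spanned by the vector `v` into itself. -/
def Fixes {n : Type*} [Fintype n] (A : Matrix n n ℂ) (v : n → ℂ) : Prop :=
  ∃ μ : ℂ, A *ᵥ v = μ • v

theorem smul_mk_eq_mk_iff {g : GL (Fin 3) ℂ} {v w : Fin 3 → ℂ} (hv : v ≠ 0) (hw : w ≠ 0) :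
    g • Projectivization.mk ℂ v hv = Projectivization.mk ℂ w hw ↔
      ∃ μ : ℂ, (g : Matrix (Fin 3) (Fin 3) ℂ) *ᵥ v = μ • w := by
  rw [Projectivization.smul_mk, Projectivization.mk_eq_mk_iff']
  exact exists_congr fun μ => eq_comm

theorem fixes_smul_iff {n : Type*} [Fintype n] {A : Matrix n n ℂ} {v : n → ℂ} {x : ℂ}
    (hx : x ≠ 0) : Fixes (x • A) v ↔ Fixes A v := by
  simp only [Fixes, smul_mulVec]
  constructor
  · rintro ⟨μ, h⟩
    exact ⟨x⁻¹ * μ, by rw [mul_smul, ← h, inv_smul_smul₀ hx]⟩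
  · rintro ⟨μ, h⟩
    exact ⟨x * μ, by rw [h, mul_smul]⟩

theorem fixes_monomialMatrix_iff {s : ℤˣ} {t a b c : Fin 3} {v : Fin 3 → ℂ} :
    Fixes (monomialMatrix s t a b c) v ↔
      ∃ μ : ℂ, ∀ i, χ (a * (i * i) + b * i) * v (modThree s * i + t) = μ * v i := by
  have h : (s : ℂ) * χ c ≠ 0 := by simp [χ_ne_zero]
  rw [← fixes_smul_iff (inv_ne_zero h)]
  simp only [Fixes, funext_iff, smul_mulVec, Pi.smul_apply, monomialMatrix_mulVec, smul_eq_mul,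
    χ_add _ c]
  refine exists_congr fun μ => forall_congr' fun i => ?_
  rw [← mul_assoc, mul_left_comm (s : ℂ), ← mul_assoc, mul_right_comm _⁻¹, inv_mul_cancel₀ h,
    one_mul]

theorem fixes_gaussianMatrix_iff {s : ℤˣ} {a b c d e : Fin 3} {v : Fin 3 → ℂ} :
    Fixes (gaussianMatrix s a b c d e) v ↔ ∃ μ : ℂ, ∀ i, χ (a * (i * i) + c * i) *
      ∑ j, χ (b * (j * j) + (modThree s * i + d) * j) * v j = μ * v i := by
  have h : (s : ℂ) * gaussSum⁻¹ * χ e ≠ 0 := by simp [χ_ne_zero, gaussSum_ne_zero]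
  rw [← fixes_smul_iff (inv_ne_zero h)]
  simp only [Fixes, funext_iff, smul_mulVec, Pi.smul_apply, gaussianMatrix_mulVec, smul_eq_mul,
    χ_add _ e]
  refine exists_congr fun μ => forall_congr' fun i => ?_
  rw [← mul_assoc, mul_left_comm (_ * _), ← mul_assoc, mul_right_comm _⁻¹, inv_mul_cancel₀ h,
    one_mul]

theorem card_stabilizer_eq {v : Fin 3 → ℂ} (hv : v ≠ 0) {F : Finset (ℤˣ × Fin 3 × Fin 3 × Fin 3)}
    {K : Finset (ℤˣ × Fin 3 × Fin 3 × Fin 3 × Fin 3)}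
    (hF : ∀ s t a b c, Fixes (monomialMatrix s t a b c) v ↔ (s, t, a, b) ∈ F)
    (hK : ∀ s a b c d e, Fixes (gaussianMatrix s a b c d e) v ↔ (s, a, b, c, d) ∈ K) :
    Nat.card (MulAction.stabilizer G25 (Projectivization.mk ℂ v hv)) = (F.card + K.card) * 3 := by
  have fixes_iff (x : ProjectiveIndex × Fin 3) :
      x ∈ (F.disjSum K) ×ˢ Finset.univ ↔
        ofIndex x ∈ MulAction.stabilizer G25 (Projectivization.mk ℂ v hv) := by
    rw [MulAction.mem_stabilizer_iff, Subgroup.smul_def, smul_mk_eq_mk_iff hv hv, coe_ofIndex,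
      ← Fixes]
    obtain ⟨⟨s, t, a, b⟩ | ⟨s, a, b, c, d⟩, e⟩ := x
    · simpa [indexMatrix] using (hF s t a b e).symm
    · simpa [indexMatrix] using (hK s a b c d e).symm
  rw [← Nat.card_congr ((Equiv.ofBijective ofIndex ofIndex_bijective).subtypeEquiv fixes_iff),
    Nat.card_eq_fintype_card, Fintype.card_coe, Finset.card_product, Finset.card_disjSum,
    Finset.card_univ, Fintype.card_fin]

theorem encard_orbit_eq {v : Fin 3 → ℂ} (hv : v ≠ 0) {F : Finset (ℤˣ × Fin 3 × Fin 3 × Fin 3)}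
    {K : Finset (ℤˣ × Fin 3 × Fin 3 × Fin 3 × Fin 3)}
    (hF : ∀ s t a b c, Fixes (monomialMatrix s t a b c) v ↔ (s, t, a, b) ∈ F)
    (hK : ∀ s a b c d e, Fixes (gaussianMatrix s a b c d e) v ↔ (s, a, b, c, d) ∈ K)
    {n : ℕ} (hn : n * (F.card + K.card) = 216) :
    (MulAction.orbit G25 (Projectivization.mk ℂ v hv)).encard = n := by
  have orbitStabilizer := Nat.card_congr
    (MulAction.orbitProdStabilizerEquivGroup G25 (Projectivization.mk ℂ v hv))
  rw [Nat.card_prod, card_G25, card_stabilizer_eq hv hF hK] at orbitStabilizer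
  have stabilizer_pos : 0 < (F.card + K.card) * 3 :=
    Nat.pos_of_ne_zero fun h => by simp [h] at orbitStabilizer
  have card_orbit : Nat.card (MulAction.orbit G25 (Projectivization.mk ℂ v hv)) = n :=
    Nat.eq_of_mul_eq_mul_right stabilizer_pos (by linarith)
  have finite_orbit : (MulAction.orbit G25 (Projectivization.mk ℂ v hv)).Finite :=
    Set.finite_range _
  rw [← finite_orbit.cast_ncard_eq, ← Nat.card_coe_set_eq, card_orbit]

section OrderNine

open IntermediateField Polynomial

theorem χ_mem_adjoin (a : Fin 3) : χ a ∈ ℚ⟮ω⟯ := by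
  rw [χ_apply]
  exact pow_mem (mem_adjoin_simple_self ℚ ω) _

theorem natDegree_minpoly_of_isPrimitiveRoot {ζ : ℂ} {n : ℕ} (hζ : IsPrimitiveRoot ζ n)
    (hn : 0 < n) : (minpoly ℚ ζ).natDegree = n.totient := by
  rw [← cyclotomic_eq_minpoly_rat hζ hn, natDegree_cyclotomic]

theorem finrank_adjoin_ω : Module.finrank ℚ ℚ⟮ω⟯ = 2 := by
  rw [adjoin.finrank (isPrimitiveRoot_ω.isIntegral three_pos).tower_top,
    natDegree_minpoly_of_isPrimitiveRoot isPrimitiveRoot_ω three_pos]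
  decide

theorem orderOf_notMem_adjoin_ω {ν : ℂ} (hν : orderOf ν = 9) : ν ∉ ℚ⟮ω⟯ := fun h => by
  have : FiniteDimensional ℚ ℚ⟮ω⟯ := Module.finite_of_finrank_pos (by simp [finrank_adjoin_ω])
  have hle := minpoly.natDegree_le (A := ℚ) (⟨ν, h⟩ : ℚ⟮ω⟯)
  rw [← minpoly.algebraMap_eq (algebraMap ℚ⟮ω⟯ ℂ).injective] at hle
  change (minpoly ℚ ν).natDegree ≤ _ at hle
  rw [natDegree_minpoly_of_isPrimitiveRoot (hν ▸ IsPrimitiveRoot.orderOf ν) (by norm_num),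
    finrank_adjoin_ω] at hle
  exact absurd hle (by decide)

theorem pow_three_ne_one_of_orderOf {ν : ℂ} (hν : orderOf ν = 9) : ν ^ 3 ≠ 1 :=
  pow_ne_one_of_lt_orderOf three_ne_zero (by rw [hν]; norm_num)

theorem exists_χ_eq_pow_three {ν : ℂ} (hν : orderOf ν = 9) : ∃ r, r ≠ 0 ∧ ν ^ 3 = χ r := by
  obtain ⟨r, hr⟩ := exists_χ_eq (x := ν ^ 3) (by
    rw [← pow_mul, show 3 * 3 = orderOf ν from hν.symm, pow_orderOf_eq_one])
  refine ⟨r, ?_, hr.symm⟩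
  rintro rfl
  exact pow_three_ne_one_of_orderOf hν (by rw [← hr, χ_zero])

theorem orderOf_eq_nine {y : ℂ} {r : Fin 3} (hr : r ≠ 0) (h : y ^ 3 = χ r) : orderOf y = 9 :=
  orderOf_eq_prime_pow (p := 3) (n := 1) (by simpa [h, χ_eq_one_iff] using hr)
    (by rw [pow_succ, pow_one, pow_mul, h, χ_pow_three])

theorem eq_zero_of_orderNine {ν x y z : ℂ} (hν : orderOf ν = 9) (hx : x ∈ ℚ⟮ω⟯) (hy : y ∈ ℚ⟮ω⟯)
    (hz : z ∈ ℚ⟮ω⟯) (h : x + y * ν + z * ν ^ 2 = 0) : x = 0 ∧ y = 0 ∧ z = 0 := by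
  obtain ⟨r, hr, hνr⟩ := exists_χ_eq_pow_three hν
  have irreducible : Irreducible (X ^ 3 - C (⟨χ r, χ_mem_adjoin r⟩ : ℚ⟮ω⟯)) := by
    refine X_pow_sub_C_irreducible_of_prime Nat.prime_three fun b hb => ?_
    exact orderOf_notMem_adjoin_ω (orderOf_eq_nine hr (congrArg Subtype.val hb)) b.2
  let q : ℚ⟮ω⟯[X] := C ⟨z, hz⟩ * X ^ 2 + C ⟨y, hy⟩ * X + C ⟨x, hx⟩
  have minpoly_eq := minpoly.eq_of_irreducible_of_monic irreducible
    (x := ν) (by simp [hνr]) (monic_X_pow_sub_C _ three_ne_zero)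
  have dvd : minpoly ℚ⟮ω⟯ ν ∣ q := minpoly.dvd _ _ (by simp [q]; linear_combination h)
  have q_eq_zero : q = 0 := by
    refine eq_zero_of_dvd_of_natDegree_lt dvd ?_
    rw [← minpoly_eq, natDegree_X_pow_sub_C]
    exact natDegree_quadratic_le.trans_lt (by norm_num)
  refine ⟨?_, ?_, ?_⟩
  · simpa [q] using congrArg (fun p => ((p.coeff 0 : ℚ⟮ω⟯) : ℂ)) q_eq_zero
  · simpa [q, coeff_X] using congrArg (fun p => ((p.coeff 1 : ℚ⟮ω⟯) : ℂ)) q_eq_zero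
  · simpa [q, coeff_X, coeff_C] using congrArg (fun p => ((p.coeff 2 : ℚ⟮ω⟯) : ℂ)) q_eq_zero

end OrderNine

theorem forall_fin_three {p : Fin 3 → Prop} : (∀ i, p i) ↔ p 0 ∧ p 1 ∧ p 2 :=
  Fin.forall_fin_succ.trans (and_congr Iff.rfl Fin.forall_fin_two)

theorem fixes_monomialMatrix_vertex_iff {s : ℤˣ} {t a b c : Fin 3} :
    Fixes (monomialMatrix s t a b c) ![0, 0, 1] ↔ t = 2 - modThree s * 2 := by
  rw [fixes_monomialMatrix_iff, ← sub_eq_zero]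
  simp only [forall_fin_three]
  fin_cases t <;> obtain rfl | rfl := Int.units_eq_one_or s <;> simp [modThree, χ_ne_zero]

theorem not_fixes_gaussianMatrix_vertex {s : ℤˣ} {a b c d e : Fin 3} :
    ¬Fixes (gaussianMatrix s a b c d e) ![0, 0, 1] := by
  rw [fixes_gaussianMatrix_iff]
  simp [forall_fin_three, Fin.sum_univ_three, χ_ne_zero]

theorem fixes_monomialMatrix_coordinate_iff {s : ℤˣ} {t a b c : Fin 3} {x : ℂ} (hx : x ≠ 0) :
    Fixes (monomialMatrix s t a b c) ![0, x, 1] ↔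
      t = 0 ∧ (s = 1 ∧ b = 0 ∨ s = -1 ∧ x ^ 2 = χ (-b)) := by
  have diagonal : χ (a + b * 2) = χ (a + b) ↔ b = 0 := by
    rw [χ_injective.eq_iff]
    clear * -
    decide +revert
  have swap : χ (a + b) = χ (a + b * 2) * x * x ↔ x ^ 2 = χ (-b) := by
    rw [show a + b = a + b * 2 + -b by ring, χ_add _ (-b), mul_assoc, ← sq,
      mul_right_inj' (χ_ne_zero _), eq_comm]
  rw [fixes_monomialMatrix_iff]
  simp only [forall_fin_three]
  fin_cases t <;> obtain rfl | rfl := Int.units_eq_one_or s <;>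
    simp [modThree, hx, diagonal, swap]

theorem χ_mul_two_sub_one (l : Fin 3) : χ (l * 2) - 1 = -χ (l * 2) * (χ l - 1) := by
  rw [mul_two, χ_add]
  linear_combination χ_pow_three l

theorem fixes_gaussianMatrix_coordinate_iff {s : ℤˣ} {a b c d e : Fin 3} {x : ℂ} :
    Fixes (gaussianMatrix s a b c d e) ![0, x, 1] ↔ x = -χ d ∧ c = -d := by
  have row_sum (u : Fin 3) :
      ∑ j, χ (b * (j * j) + u * j) * ![0, x, 1] j = χ (b + u) * (x + χ u) := by
    simp [Fin.sum_univ_three, χ_add, mul_add, mul_two, mul_assoc]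
  have first_row : χ (b + d) * (x + χ d) = 0 ↔ x = -χ d := by
    rw [mul_eq_zero, or_iff_right (χ_ne_zero _), eq_neg_iff_add_eq_zero]
  simp only [fixes_gaussianMatrix_iff, row_sum, forall_fin_three]
  simp only [mul_zero, add_zero, χ_zero, one_mul, zero_add, cons_val_zero, first_row,
    exists_and_left]
  refine and_congr_right fun hx => ?_
  subst hx
  simp only [cons_val, mul_one, exists_eq_right']
  have χ_sign_ne : χ (modThree s) - 1 ≠ 0 := by
    rw [sub_ne_zero, Ne, χ_eq_one_iff]
    exact (by decide : ∀ s, modThree s ≠ 0) s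
  have second_row : χ (a + c) * (χ (b + (modThree s + d)) * (-χ d + χ (modThree s + d))) =
      χ (a + c + b + modThree s + d + d) * (χ (modThree s) - 1) := by
    simp only [χ_add]
    ring
  have third_row : χ (a * (2 * 2) + c * 2) *
      (χ (b + (modThree s * 2 + d)) * (-χ d + χ (modThree s * 2 + d))) * -χ d =
      χ (a * (2 * 2) + c * 2 + b + modThree s * 2 + d + d + d + modThree s * 2) *
        (χ (modThree s) - 1) := by
    simp only [χ_add _ (modThree s * 2), χ_add _ d, χ_add _ b, χ_add b, χ_add]
    linear_combination -χ (a * (2 * 2)) * χ (c * 2) * χ b * χ (modThree s * 2) * χ d ^ 3 *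
      χ_mul_two_sub_one (modThree s)
  rw [second_row, third_row, mul_left_inj' χ_sign_ne, χ_injective.eq_iff]
  clear * -
  decide +revert

theorem axis_apply_of_ne_zero (x : ℂ) : ∀ {i : Fin 3}, i ≠ 0 → ![x, 1, 1] i = 1
  | 0, h => absurd rfl h
  | 1, _ => rfl
  | 2, _ => rfl

theorem fixes_monomialMatrix_axis_iff {s : ℤˣ} {t a b c : Fin 3} {x : ℂ} (hx₀ : x ≠ 0)
    (hx : x ^ 3 ≠ 1) :
    Fixes (monomialMatrix s t a b c) ![x, 1, 1] ↔ t = 0 ∧ a = 0 ∧ b = 0 := by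
  rw [fixes_monomialMatrix_iff]
  constructor
  · rintro ⟨μ, h⟩
    have h_cube (i : Fin 3) : ![x, 1, 1] (modThree s * i + t) ^ 3 = μ ^ 3 * ![x, 1, 1] i ^ 3 := by
      rw [← mul_pow, ← h, mul_pow, χ_pow_three, one_mul]
    have ht : t = 0 := by
      by_contra ht
      have μ_cube : μ ^ 3 = 1 := by
        have := h_cube (modThree s * t)
        rw [axis_apply_of_ne_zero x (by clear * - ht; decide +revert),
          axis_apply_of_ne_zero x (by clear * - ht; decide +revert)] at this
        simpa using this.symm
      have := h_cube 0
      rw [mul_zero, zero_add, axis_apply_of_ne_zero x ht, μ_cube] at this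
      exact hx (by simpa using this.symm)
    subst ht
    have hμ : μ = 1 := by simpa [hx₀] using h 0
    have phase {i : Fin 3} (hi : i ≠ 0) : a * (i * i) + b * i = 0 := by
      have := h i
      rwa [axis_apply_of_ne_zero x hi,
        axis_apply_of_ne_zero x (by clear * - hi; decide +revert), hμ, mul_one, one_mul,
        χ_eq_one_iff] at this
    have h₁ : a * (1 * 1) + b * 1 = 0 := phase (by decide)
    have h₂ : a * (2 * 2) + b * 2 = 0 := phase (by decide)
    clear * - h₁ h₂
    decide +revert
  · rintro ⟨rfl, rfl, rfl⟩
    refine ⟨1, ?_⟩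
    obtain rfl | rfl := Int.units_eq_one_or s <;> simp [forall_fin_three, modThree]

theorem χ_add_χ_two_mul (u : Fin 3) : χ u + χ (u * 2) = if u = 0 then 2 else -1 := by
  have h := sum_χ_mul u
  rw [Fin.sum_univ_three, mul_zero, mul_one, χ_zero, add_assoc] at h
  split_ifs at h ⊢ <;> linear_combination h

theorem sum_χ_quadratic_axis (b u : Fin 3) (x : ℂ) :
    ∑ j, χ (b * (j * j) + u * j) * ![x, 1, 1] j =
      if u = 0 then x + 2 * χ b else x - χ b := by
  have h := χ_add_χ_two_mul u
  simp only [Fin.sum_univ_three, cons_val]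
  simp only [mul_zero, add_zero, χ_zero, one_mul, mul_one, χ_add, Fin.reduceMul]
  split_ifs at h ⊢ <;> linear_combination χ b * h

theorem fixes_gaussianMatrix_axis_iff {s : ℤˣ} {a b c d e : Fin 3} {x : ℂ} (hx : x ^ 3 ≠ 1) :
    Fixes (gaussianMatrix s a b c d e) ![x, 1, 1] ↔
      c = 0 ∧ d = 0 ∧ x + 2 * χ b = χ a * (x - χ b) * x := by
  have hb : x - χ b ≠ 0 := sub_ne_zero.mpr fun h => hx (h ▸ χ_pow_three b)
  simp only [fixes_gaussianMatrix_iff, sum_χ_quadratic_axis]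
  constructor
  · rintro ⟨μ, h⟩
    have hd : d = 0 := by
      by_contra hd
      have h_cube {i : Fin 3} (hi : modThree s * i + d ≠ 0) :
          (x - χ b) ^ 3 = μ ^ 3 * ![x, 1, 1] i ^ 3 := by
        rw [← mul_pow, ← h, if_neg hi, mul_pow, χ_pow_three, one_mul]
      have h₀ := h_cube (i := 0) (by simpa using hd)
      have h₁ := h_cube (i := modThree s * d) (by clear * - hd; decide +revert)
      rw [axis_apply_of_ne_zero x (by clear * - hd; decide +revert), one_pow, mul_one] at h₁
      rw [h₁, left_eq_mul₀ (h₁ ▸ pow_ne_zero 3 hb)] at h₀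
      exact hx h₀
    subst hd
    have eigenvalue {i : Fin 3} (hi : i ≠ 0) : χ (a * (i * i) + c * i) * (x - χ b) = μ := by
      have := h i
      rwa [axis_apply_of_ne_zero x hi, if_neg (by clear * - hi; decide +revert), mul_one] at this
    have hc : c = 0 := by
      have := mul_right_cancel₀ hb ((eigenvalue one_ne_zero).trans
        (eigenvalue (i := 2) (by decide)).symm)
      have := χ_injective this
      clear * - this
      decide +revert
    subst hc
    refine ⟨rfl, rfl, ?_⟩
    rw [show χ a * (x - χ b) = μ by simpa using eigenvalue one_ne_zero]
    simpa using h 0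
  · rintro ⟨rfl, rfl, h⟩
    refine ⟨χ a * (x - χ b), ?_⟩
    obtain rfl | rfl := Int.units_eq_one_or s <;> simp [forall_fin_three, modThree, h]

section OrderNineStabilizer

variable {ν : ℂ}

theorem orderNine_apply_pow_three {r : Fin 3} (hr : ν ^ 3 = χ r) :
    ∀ i, ![ν, ν ^ 2, 1] i ^ 3 = χ (r * (i + 1))
  | 0 => by simp [hr]
  | 1 => by
    change (ν ^ 2) ^ 3 = χ (r * 2)
    rw [pow_right_comm, hr, mul_two, χ_add, sq]
  | 2 => by simp

theorem orderNine_translate {r : Fin 3} (hr : ν ^ 3 = χ r) (hν : ν ≠ 0) (t i : Fin 3) :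
    ![ν, ν ^ 2, 1] (i + t) = χ (r * t * (i * i) + r * (t * t) * i) *
      (![ν, ν ^ 2, 1] t / ν) * ![ν, ν ^ 2, 1] i := by
  have h₂ : χ (r + r) = ν ^ 6 := by rw [χ_add, ← hr]; ring
  have h₃ : r + r * 2 = 0 := by linear_combination r * three_eq_zero
  have h₄ : r * 2 + r * 2 = r := by linear_combination r * three_eq_zero
  have h₉ : ν ^ 9 = 1 := by rw [← χ_pow_three r, ← hr, ← pow_mul]
  fin_cases t <;> fin_cases i <;> simp [hν, h₂, h₃, h₄, add_comm (r * 2) r, ← hr] <;> field_simp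
  rw [h₉]

theorem ne_zero_of_orderNine (hν : orderOf ν = 9) : ν ≠ 0 := by
  rintro rfl
  simp at hν

theorem orderNine_apply_ne_zero (hν : ν ≠ 0) : ∀ i, ![ν, ν ^ 2, 1] i ≠ 0
  | 0 => hν
  | 1 => pow_ne_zero 2 hν
  | 2 => one_ne_zero

theorem fixes_monomialMatrix_orderNine_iff (hν : orderOf ν = 9) {r : Fin 3} (hr : ν ^ 3 = χ r)
    {s : ℤˣ} {t a b c : Fin 3} :
    Fixes (monomialMatrix s t a b c) ![ν, ν ^ 2, 1] ↔
      s = 1 ∧ a = -(r * t) ∧ b = -(r * (t * t)) := by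
  have hν₀ := ne_zero_of_orderNine hν
  have hr₀ : r ≠ 0 := fun h => pow_three_ne_one_of_orderOf hν (by rw [hr, h, χ_zero])
  rw [fixes_monomialMatrix_iff]
  constructor
  · rintro ⟨μ, h⟩
    have h_cube (i : Fin 3) : χ (r * (modThree s * i + t + 1)) = μ ^ 3 * χ (r * (i + 1)) := by
      rw [← orderNine_apply_pow_three hr, ← orderNine_apply_pow_three hr, ← mul_pow, ← h, mul_pow,
        χ_pow_three, one_mul]
    have hs : s = 1 := by
      have hμ : χ (r * (modThree s * 2 + t + 1)) = μ ^ 3 := by simpa using h_cube 2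
      have h₀ := h_cube 0
      rw [← hμ, ← χ_add, χ_injective.eq_iff] at h₀
      clear * - h₀ hr₀
      decide +revert
    subst hs
    simp only [modThree_one, one_mul, orderNine_translate hr hν₀] at h
    have hμ : μ = ![ν, ν ^ 2, 1] t / ν :=
      eq_div_of_mul_eq hν₀ (by simpa [hν₀] using (h 0).symm)
    have phase (i : Fin 3) :
        (a + r * t) * (i * i) + (b + r * (t * t)) * i + 0 = 0 * (i * i) + 0 * i + 0 := by
      have := h i
      rw [hμ, ← mul_assoc, ← mul_assoc, ← χ_add, mul_assoc, mul_eq_right₀ (mul_ne_zero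
        (div_ne_zero (orderNine_apply_ne_zero hν₀ t) hν₀) (orderNine_apply_ne_zero hν₀ i)),
        χ_eq_one_iff] at this
      linear_combination this
    obtain ⟨ha, hb, -⟩ := eq_of_forall_quadratic_eq phase
    exact ⟨rfl, eq_neg_of_add_eq_zero_left ha, eq_neg_of_add_eq_zero_left hb⟩
  · rintro ⟨rfl, rfl, rfl⟩
    refine ⟨![ν, ν ^ 2, 1] t / ν, fun i => ?_⟩
    rw [modThree_one, one_mul, orderNine_translate hr hν₀, ← mul_assoc, ← mul_assoc, ← χ_add]
    simp [← add_assoc, add_right_comm _ (-(r * (t * t) * i))]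

theorem not_fixes_gaussianMatrix_orderNine (hν : orderOf ν = 9) {s : ℤˣ} {a b c d e : Fin 3} :
    ¬Fixes (gaussianMatrix s a b c d e) ![ν, ν ^ 2, 1] := by
  obtain ⟨r, hr, hνr⟩ := exists_χ_eq_pow_three hν
  rw [fixes_gaussianMatrix_iff]
  rintro ⟨μ, h⟩
  have row_sum (u : Fin 3) : ∑ j, χ (b * (j * j) + u * j) * ![ν, ν ^ 2, 1] j =
      χ (b + u * 2) + ν + χ (b + u) * ν ^ 2 := by
    simp only [Fin.sum_univ_three, mul_zero, add_zero, χ_zero, one_mul, mul_one, cons_val,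
      Fin.reduceMul]
    ring
  simp only [row_sum] at h
  have h₀ := h 0
  rw [show μ = _ by simpa using (h 2).symm] at h₀
  simp only [mul_zero, zero_add, add_zero, χ_zero, one_mul, cons_val_zero] at h₀
  obtain ⟨e₀, e₁, e₂⟩ := eq_zero_of_orderNine hν
    (x := χ (b + d * 2) - χ (a + c * 2) * (χ (b + (modThree s * 2 + d)) * χ r))
    (y := 1 - χ (a + c * 2) * χ (b + (modThree s * 2 + d) * 2))
    (z := χ (b + d) - χ (a + c * 2))
    (sub_mem (χ_mem_adjoin _) (mul_mem (χ_mem_adjoin _) (mul_mem (χ_mem_adjoin _)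
      (χ_mem_adjoin _))))
    (sub_mem (one_mem _) (mul_mem (χ_mem_adjoin _) (χ_mem_adjoin _)))
    (sub_mem (χ_mem_adjoin _) (χ_mem_adjoin _)) (by
      linear_combination h₀ + χ (a + c * 2) * χ (b + (modThree s * 2 + d)) * hνr)
  simp only [sub_eq_zero, ← χ_add, χ_injective.eq_iff] at e₀ e₂
  rw [sub_eq_zero, eq_comm, ← χ_add, χ_eq_one_iff] at e₁
  apply hr
  linear_combination -e₀ + e₁ - e₂ - (a + 2 * c + 2 * modThree s) * three_eq_zero

end OrderNineStabilizer

theorem encard_orbit_vertex : (MulAction.orbit G25 (line 0 0)).encard = 12 :=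
  encard_orbit_eq _ (F := {p | p.2.1 = 2 - modThree p.1 * 2}) (K := ∅)
    (fun _ _ _ _ _ => fixes_monomialMatrix_vertex_iff.trans (by simp))
    (fun _ _ _ _ _ _ => by simp [not_fixes_gaussianMatrix_vertex]) (n := 12) (by decide)

theorem encard_orbit_coordinate {x : ℂ} (hx : x ≠ 0) (h : x ^ 6 ≠ 1) :
    (MulAction.orbit G25 (line 0 x)).encard = 72 := by
  refine encard_orbit_eq _ (F := {p | p.1 = 1 ∧ p.2.1 = 0 ∧ p.2.2.2 = 0}) (K := ∅)
    (fun s t a b c => (fixes_monomialMatrix_coordinate_iff hx).trans ?_)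
    (fun s a b c d e => fixes_gaussianMatrix_coordinate_iff.trans ?_) (n := 72) (by decide)
  · have : x ^ 2 ≠ χ (-b) := fun hb => h (by rw [pow_mul x 2 3, hb, χ_pow_three])
    simp only [this, and_false, or_false, Finset.mem_filter, Finset.mem_univ, true_and]
    tauto
  · have : x ≠ -χ d := fun hd => h (by
      rw [hd, Even.neg_pow (by decide), pow_mul (χ d) 3 2, χ_pow_three, one_pow])
    simp [this]

theorem encard_orbit_mirrorCenter : (MulAction.orbit G25 (line 0 1)).encard = 36 := by
  refine encard_orbit_eq _ (F := {p | p.2.1 = 0 ∧ p.2.2.2 = 0}) (K := ∅)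
    (fun s t a b c => (fixes_monomialMatrix_coordinate_iff one_ne_zero).trans ?_)
    (fun s a b c d e => fixes_gaussianMatrix_coordinate_iff.trans ?_) (n := 36) (by decide)
  · rw [one_pow, eq_comm (a := (1 : ℂ)), χ_eq_one_iff, neg_eq_zero, ← or_and_right,
      and_iff_right (Int.units_eq_one_or s)]
    simp
  · have : (1 : ℂ) ≠ -χ d := fun hd => by
      have := χ_pow_three d
      rw [← neg_eq_iff_eq_neg.mpr hd] at this
      norm_num at this
    simp [this]

theorem encard_orbit_center : (MulAction.orbit G25 (line 0 (-1))).encard = 9 := by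
  refine encard_orbit_eq _ (F := {p | p.2.1 = 0 ∧ p.2.2.2 = 0})
    (K := {p | p.2.2.2.1 = 0 ∧ p.2.2.2.2 = 0})
    (fun s t a b c => (fixes_monomialMatrix_coordinate_iff (neg_ne_zero.mpr one_ne_zero)).trans ?_)
    (fun s a b c d e => fixes_gaussianMatrix_coordinate_iff.trans ?_) (n := 9) (by decide)
  · rw [neg_one_sq, eq_comm (a := (1 : ℂ)), χ_eq_one_iff, neg_eq_zero, ← or_and_right,
      and_iff_right (Int.units_eq_one_or s)]
    simp
  · rw [neg_inj, eq_comm, χ_eq_one_iff]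
    simp only [Finset.mem_filter_univ]
    clear * -
    decide +revert

theorem χ_sq_add_χ_add_one {a : Fin 3} (ha : a ≠ 0) : χ a ^ 2 + χ a + 1 = 0 := by
  refine (mul_eq_zero.mp ?_).resolve_left (sub_ne_zero.mpr (mt χ_eq_one_iff.mp ha))
  linear_combination χ_pow_three a

theorem pow_three_eq_or_of_gaussian_fixed {x : ℂ} {a b : Fin 3} (hx : x ^ 3 ≠ 1)
    (h : x + 2 * χ b = χ a * (x - χ b) * x) :
    x ^ 3 = -8 ∨ a + b = 0 ∧ (χ a * x) ^ 2 - 2 * (χ a * x) - 2 = 0 := by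
  have h_quadratic :
      (χ a * x) ^ 2 - (χ (a + b) + 1) * (χ a * x) - 2 * χ (a + b) = 0 := by
    rw [χ_add]
    linear_combination -χ a * h
  by_cases hab : a + b = 0
  · refine Or.inr ⟨hab, ?_⟩
    rw [hab, χ_zero] at h_quadratic
    linear_combination h_quadratic
  · have factored : (χ a * x + 2 * χ (a + b) ^ 2) * (χ a * x - χ (a + b) ^ 2) = 0 := by
      linear_combination h_quadratic + χ a * x * χ_sq_add_χ_add_one hab -
        2 * χ (a + b) * χ_pow_three (a + b)
    have x_cube (z : ℂ) (hz : χ a * x = z * χ (a + b) ^ 2) : x ^ 3 = z ^ 3 := by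
      rw [← one_mul (x ^ 3), ← χ_pow_three a, ← mul_pow, hz, mul_pow, pow_right_comm, χ_pow_three,
        one_pow, mul_one]
    rcases mul_eq_zero.mp factored with h | h
    · left
      rw [x_cube (-2) (by linear_combination h)]
      norm_num
    · exact absurd ((x_cube 1 (by linear_combination h)).trans (one_pow 3)) hx

theorem encard_orbit_axis {x : ℂ} (hx₀ : x ≠ 0) (hx₁ : x ^ 3 ≠ 1) (hx₂ : x ^ 3 ≠ -8)
    (hx₃ : x ^ 6 - 20 * x ^ 3 - 8 ≠ 0) : (MulAction.orbit G25 (line x 1)).encard = 108 := by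
  refine encard_orbit_eq _ (F := {p | p.2.1 = 0 ∧ p.2.2.1 = 0 ∧ p.2.2.2 = 0}) (K := ∅)
    (fun s t a b c => (fixes_monomialMatrix_axis_iff hx₀ hx₁).trans (by simp))
    (fun s a b c d e => (fixes_gaussianMatrix_axis_iff hx₁).trans
      (iff_of_false ?_ (Finset.notMem_empty _))) (n := 108) (by decide)
  rintro ⟨-, -, h⟩
  obtain h | ⟨-, h⟩ := pow_three_eq_or_of_gaussian_fixed hx₁ h
  · exact hx₂ h
  · apply hx₃
    have hy : (χ a * x) ^ 3 = x ^ 3 := by rw [mul_pow, χ_pow_three, one_mul]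
    rw [pow_mul x 3 2, ← hy]
    linear_combination
      ((χ a * x) ^ 4 + 2 * (χ a * x) ^ 3 + 6 * (χ a * x) ^ 2 - 4 * (χ a * x) + 4) * h

theorem axis_ne_of_quadratic {x : ℂ} (hx : x ^ 2 - 2 * x - 2 = 0) :
    x ≠ 0 ∧ x ^ 3 ≠ 1 ∧ x ^ 3 ≠ -8 := by
  have x_cube : x ^ 3 = 6 * x + 4 := by linear_combination (x + 2) * hx
  refine ⟨?_, fun h => ?_, fun h => ?_⟩
  · rintro rfl
    norm_num at hx
  · have : x = -1 / 2 := by linear_combination (h - x_cube) / 6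
    norm_num [this] at hx
  · have : x = -2 := by linear_combination (h - x_cube) / 6
    norm_num [this] at hx

theorem encard_orbit_axis_of_quadratic {x : ℂ} (hx : x ^ 2 - 2 * x - 2 = 0) :
    (MulAction.orbit G25 (line x 1)).encard = 54 := by
  obtain ⟨hx₀, hx₁, hx₂⟩ := axis_ne_of_quadratic hx
  refine encard_orbit_eq _ (F := {p | p.2.1 = 0 ∧ p.2.2.1 = 0 ∧ p.2.2.2 = 0})
    (K := {p | p.2.1 = 0 ∧ p.2.2.1 = 0 ∧ p.2.2.2.1 = 0 ∧ p.2.2.2.2 = 0})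
    (fun s t a b c => (fixes_monomialMatrix_axis_iff hx₀ hx₁).trans (by simp))
    (fun s a b c d e => (fixes_gaussianMatrix_axis_iff hx₁).trans ?_) (n := 54) (by decide)
  rw [Finset.mem_filter_univ]
  constructor
  · rintro ⟨rfl, rfl, h⟩
    obtain h | ⟨hab, h⟩ := pow_three_eq_or_of_gaussian_fixed hx₁ h
    · exact absurd h hx₂
    · have ha : a = 0 := by
        by_contra ha
        have sum_powers := χ_sq_add_χ_add_one ha
        have factored : (χ a - 1) * (χ a * (x - χ a)) = 0 := by
          linear_combination (h - χ a ^ 2 * hx) / 2 - (χ a - 1) * sum_powers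
        have : x = χ a := by
          simpa [sub_eq_zero, χ_eq_one_iff, ha, χ_ne_zero] using factored
        exact hx₁ (this ▸ χ_pow_three a)
      subst ha
      exact ⟨rfl, by simpa using hab, rfl, rfl⟩
  · rintro ⟨rfl, rfl, rfl, rfl⟩
    refine ⟨rfl, rfl, ?_⟩
    rw [χ_zero]
    linear_combination -hx

theorem encard_orbit_orderNine {ν : ℂ} (hν : orderOf ν = 9) :
    (MulAction.orbit G25 (line ν (ν ^ 2))).encard = 72 := by
  obtain ⟨r, -, hr⟩ := exists_χ_eq_pow_three hν
  refine encard_orbit_eq _ (F := {p | p.1 = 1 ∧ p.2.2.1 = -(r * p.2.1) ∧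
    p.2.2.2 = -(r * (p.2.1 * p.2.1))}) (K := ∅)
    (fun s t a b c => (fixes_monomialMatrix_orderNine_iff hν hr).trans (by simp))
    (fun s a b c d e => by simp [not_fixes_gaussianMatrix_orderNine hν]) (n := 72) ?_
  clear * -
  decide +revert

section Representatives

variable {v w : Fin 3 → ℂ} (hv : v ≠ 0)

include hv in
theorem mulVec_ne_zero_of_mem_hessianMonoid {A : Matrix (Fin 3) (Fin 3) ℂ}
    (hA : A ∈ hessianMonoid) : A *ᵥ v ≠ 0 := by
  obtain ⟨g, -, rfl⟩ := exists_mem_G25_coe_eq hA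
  intro h
  exact hv (by simpa using congrArg ((g⁻¹ : GL (Fin 3) ℂ) : Matrix (Fin 3) (Fin 3) ℂ).mulVec h)

theorem orbitOf_mk_eq (hw : w ≠ 0) {A : Matrix (Fin 3) (Fin 3) ℂ} (hA : A ∈ hessianMonoid)
    {μ : ℂ} (h : A *ᵥ v = μ • w) :
    orbitOf (Projectivization.mk ℂ v hv) = orbitOf (Projectivization.mk ℂ w hw) := by
  obtain ⟨g, hg, rfl⟩ := exists_mem_G25_coe_eq hA
  symm
  exact Quotient.sound ⟨⟨g, hg⟩, (smul_mk_eq_mk_iff hv hw).mpr ⟨μ, h⟩⟩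

theorem orbitOf_mk_eq_of_pow_three_eq (hw : w ≠ 0) {κ : ℂ} (h : ∀ i, v i ^ 3 = κ * w i ^ 3) :
    orbitOf (Projectivization.mk ℂ v hv) = orbitOf (Projectivization.mk ℂ w hw) := by
  obtain ⟨y, rfl⟩ := IsAlgClosed.exists_pow_nat_eq κ three_pos
  have phase (i : Fin 3) : ∃ k, v i = χ k * (y * w i) := by
    by_cases hi : y * w i = 0
    · exact ⟨0, by rw [hi, mul_zero, ← pow_eq_zero_iff three_ne_zero, h, ← mul_pow, hi]; simp⟩
    · exact exists_eq_χ_mul_of_pow_three_eq hi (by rw [h, mul_pow])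
  choose k hk using phase
  obtain ⟨a, b, c, interpolation⟩ :
      ∃ a b c, ∀ i, a * (i * i) + b * i + c = -k i :=
    ⟨k 1 + k 2 - 2 * k 0, k 1 - k 2, -k 0, forall_fin_three.mpr
      ⟨by ring, by linear_combination (k 1 - k 0) * three_eq_zero,
        by linear_combination (2 * k 1 + k 2 - 3 * k 0) * three_eq_zero⟩⟩
  refine orbitOf_mk_eq hv hw (monomialMatrix_mem_hessianMonoid 1 0 a b c) (μ := y) ?_
  ext i
  rw [monomialMatrix_mulVec, interpolation, modThree_one, one_mul, add_zero, hk]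
  rw [Units.val_one, Int.cast_one, one_mul, ← mul_assoc, ← χ_add, neg_add_cancel, χ_zero, one_mul,
    Pi.smul_apply, smul_eq_mul]

theorem orbitOf_line_eq_of_pow_three_eq {x y x' y' : ℂ} (hx : x ^ 3 = x' ^ 3)
    (hy : y ^ 3 = y' ^ 3) : orbitOf (line x y) = orbitOf (line x' y') :=
  orbitOf_mk_eq_of_pow_three_eq _ _ (κ := 1) (by simp [forall_fin_three, hx, hy])

theorem orbitOf_mk_eq_line {t : Fin 3} (ht : v (t + 2) ≠ 0) :
    orbitOf (Projectivization.mk ℂ v hv) =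
      orbitOf (line (v t / v (t + 2)) (v (t + 1) / v (t + 2))) := by
  refine orbitOf_mk_eq hv _ (monomialMatrix_mem_hessianMonoid 1 t 0 0 0) (μ := v (t + 2)) ?_
  simp [funext_iff, forall_fin_three, monomialMatrix_mulVec, modThree_one, add_comm _ t,
    mul_div_cancel₀ _ ht]

/-- The orbits of the lines with a nontrivial projective stabilizer, up to repetitions. -/
inductive IsSpecialOrbit : LineOrbit → Prop
  | coordinate (x : ℂ) : IsSpecialOrbit (orbitOf (line 0 x))
  | axis (x : ℂ) : IsSpecialOrbit (orbitOf (line x 1))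
  | orderNine {ν : ℂ} (hν : orderOf ν = 9) : IsSpecialOrbit (orbitOf (line ν (ν ^ 2)))

theorem isSpecialOrbit_of_apply_eq_zero {i : Fin 3} (hi : v i = 0) :
    IsSpecialOrbit (orbitOf (Projectivization.mk ℂ v hv)) := by
  by_cases h : v (i + 2) = 0
  · have h' : v (i + 2 + 2) ≠ 0 := fun h' => hv <| by
      have key : ∀ i j : Fin 3, j = i ∨ j = i + 2 ∨ j = i + 2 + 2 := by decide
      ext j
      obtain rfl | rfl | rfl := key i j
      exacts [hi, h, h']
    rw [orbitOf_mk_eq_line hv h', h, zero_div]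
    exact .coordinate _
  · rw [orbitOf_mk_eq_line hv h, hi, zero_div]
    exact .coordinate _

theorem isSpecialOrbit_of_fixes_diagonal {a b c : Fin 3} (hab : ¬(a = 0 ∧ b = 0))
    (h : Fixes (monomialMatrix 1 0 a b c) v) :
    IsSpecialOrbit (orbitOf (Projectivization.mk ℂ v hv)) := by
  obtain ⟨μ, h⟩ := fixes_monomialMatrix_iff.mp h
  by_contra hspecial
  have hv' (i : Fin 3) : v i ≠ 0 := fun hi => hspecial (isSpecialOrbit_of_apply_eq_zero hv hi)
  simp only [modThree_one, one_mul, add_zero, mul_left_inj' (hv' _)] at h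
  have phase_eq (i : Fin 3) : a * (i * i) + b * i = 0 := by
    rw [← χ_eq_one_iff, h, ← h 0, mul_zero, mul_zero, mul_zero, add_zero, χ_zero]
  refine hab ?_
  have h₁ := phase_eq 1
  have h₂ := phase_eq 2
  clear * - h₁ h₂
  decide +revert

theorem isSpecialOrbit_of_fixes_translation {t a b c : Fin 3} (ht : t ≠ 0)
    (h : Fixes (monomialMatrix 1 t a b c) v) :
    IsSpecialOrbit (orbitOf (Projectivization.mk ℂ v hv)) := by
  obtain ⟨μ, h⟩ := fixes_monomialMatrix_iff.mp h
  have h_cube (i : Fin 3) : v (i + t) ^ 3 = μ ^ 3 * v i ^ 3 := by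
    rw [← mul_pow, ← h, mul_pow, χ_pow_three, modThree_one, one_mul, one_mul]
  by_cases h₂ : v 2 = 0
  · exact isSpecialOrbit_of_apply_eq_zero hv h₂
  have h_cycle : v (2 + t + t + t) ^ 3 = (μ ^ 3) ^ 3 * v 2 ^ 3 := by simp only [h_cube]; ring
  rw [show 2 + t + t + t = 2 by linear_combination t * three_eq_zero] at h_cycle
  obtain ⟨q, hq⟩ := exists_χ_eq ((mul_eq_right₀ (pow_ne_zero 3 h₂)).mp h_cycle.symm)
  obtain ⟨ν, hν⟩ := IsAlgClosed.exists_pow_nat_eq (χ (q * t)) three_pos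
  have iterate : ∀ k, v (2 + k * t) ^ 3 = v 2 ^ 3 * χ (q * k) := by
    rw [forall_fin_three, mul_zero, mul_one, mul_two, two_mul, ← add_assoc, χ_add, χ_zero, hq]
    simp only [h_cube, zero_mul, one_mul, add_zero]
    exact ⟨by ring, by ring, by ring⟩
  have orbit_eq : orbitOf (Projectivization.mk ℂ v hv) = orbitOf (line ν (ν ^ 2)) := by
    refine orbitOf_mk_eq_of_pow_three_eq hv _ (κ := v 2 ^ 3) fun i => ?_
    rw [orderNine_apply_pow_three hν, mul_assoc, ← iterate]
    congr 2
    clear * - ht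
    decide +revert
  rw [orbit_eq]
  by_cases hqt : q * t = 0
  · rw [hqt, χ_zero] at hν
    rw [orbitOf_line_eq_of_pow_three_eq (x' := 1) (y' := 1) (by rw [hν, one_pow])
      (by rw [pow_right_comm, hν, one_pow, one_pow])]
    exact .axis 1
  · exact .orderNine (orderOf_eq_nine hqt hν)

theorem isSpecialOrbit_of_fixes_involution {t a b c : Fin 3}
    (h : Fixes (monomialMatrix (-1) t a b c) v) :
    IsSpecialOrbit (orbitOf (Projectivization.mk ℂ v hv)) := by
  obtain ⟨μ, h⟩ := fixes_monomialMatrix_iff.mp h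
  by_contra hspecial
  have hv' (i : Fin 3) : v i ≠ 0 := fun hi => hspecial (isSpecialOrbit_of_apply_eq_zero hv hi)
  have h_cube (i : Fin 3) : v (-i + t) ^ 3 = μ ^ 3 * v i ^ 3 := by
    rw [← mul_pow, ← h, mul_pow, χ_pow_three, modThree_neg, modThree_one, neg_one_mul, one_mul]
  have center : -(-t) + t = -t := by linear_combination t * three_eq_zero
  have μ_cube : μ ^ 3 = 1 := by
    have := h_cube (-t)
    rw [center] at this
    exact (mul_eq_right₀ (pow_ne_zero 3 (hv' _))).mp this.symm
  have side : -(-t + 2) + t = -t + 1 := by linear_combination (t - 1) * three_eq_zero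
  have h_side := h_cube (-t + 2)
  rw [side, μ_cube, one_mul] at h_side
  rw [orbitOf_mk_eq_line hv (hv' (-t + 2)),
    orbitOf_line_eq_of_pow_three_eq (y' := 1) rfl (by simp [div_pow, h_side, hv'])] at hspecial
  exact hspecial (.axis _)

theorem isSpecialOrbit_of_fixes_monomialMatrix {s : ℤˣ} {t a b c : Fin 3}
    (hA : ¬(s = 1 ∧ t = 0 ∧ a = 0 ∧ b = 0)) (h : Fixes (monomialMatrix s t a b c) v) :
    IsSpecialOrbit (orbitOf (Projectivization.mk ℂ v hv)) := by
  obtain rfl | rfl := Int.units_eq_one_or s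
  · by_cases ht : t = 0
    · subst ht
      exact isSpecialOrbit_of_fixes_diagonal hv (by simpa using hA) h
    · exact isSpecialOrbit_of_fixes_translation hv ht h
  · exact isSpecialOrbit_of_fixes_involution hv h

theorem Fixes.mul {n : Type*} [Fintype n] {A B : Matrix n n ℂ} {v : n → ℂ} (hA : Fixes A v)
    (hB : Fixes B v) : Fixes (A * B) v := by
  obtain ⟨μ, hA⟩ := hA
  obtain ⟨μ', hB⟩ := hB
  exact ⟨μ' * μ, by rw [← mulVec_mulVec, hB, mulVec_smul, hA, mul_smul]⟩

theorem Fixes.of_mul_eq_mul {n : Type*} [Fintype n] {A B C : Matrix n n ℂ} {v : n → ℂ}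
    (hA : Fixes A v) (h : C * A = B * C) : Fixes B (C *ᵥ v) := by
  obtain ⟨μ, hA⟩ := hA
  exact ⟨μ, by rw [mulVec_mulVec, ← h, ← mulVec_mulVec, hA, mulVec_smul]⟩

theorem exists_mul_gaussianMatrix_eq_monomialMatrix_mul {s : ℤˣ} {a b c d e : Fin 3}
    (hab : a + b ≠ 0) : ∃ C ∈ hessianMonoid, ∃ s' t' a' b' c', a' ≠ 0 ∧
      C * gaussianMatrix s a b c d e = monomialMatrix s' t' a' b' c' * C := by
  obtain ⟨σ, hσ⟩ := exists_modThree_eq (neg_ne_zero.mpr hab)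
  have h : a - b + a = modThree σ := by linear_combination a * three_eq_zero - hσ
  refine ⟨gaussianMatrix 1 0 (a - b) 0 0 0, gaussianMatrix_mem_hessianMonoid ..,
    s * σ, d + modThree (s * σ) * c, -modThree σ, modThree σ * c,
    e - modThree σ * (c * c), by rwa [hσ, neg_neg], ?_⟩
  rw [gaussianMatrix_mul_gaussianMatrix_of_add_eq (h := h), monomialMatrix_mul_gaussianMatrix]
  congr 1
  case e_b => linear_combination (b - a) * three_eq_zero + h
  all_goals simp [modThree_one]

theorem isSpecialOrbit_of_fixes_gaussianMatrix {s : ℤˣ} {a b c d e : Fin 3}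
    (h : Fixes (gaussianMatrix s a b c d e) v) :
    IsSpecialOrbit (orbitOf (Projectivization.mk ℂ v hv)) := by
  by_cases hab : a + b = 0
  · have h' := h.mul h
    rw [gaussianMatrix_mul_gaussianMatrix_of_add_eq_zero (h := by rwa [add_comm]),
      Int.units_mul_self] at h'
    exact isSpecialOrbit_of_fixes_involution hv h'
  · obtain ⟨C, hC, s', t', a', b', c', ha', hCA⟩ :=
      exists_mul_gaussianMatrix_eq_monomialMatrix_mul hab
    rw [orbitOf_mk_eq hv (mulVec_ne_zero_of_mem_hessianMonoid hv hC) hC (one_smul ..).symm]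
    exact isSpecialOrbit_of_fixes_monomialMatrix _ (fun h => ha' h.2.2.1) (h.of_mul_eq_mul hCA)

end Representatives

theorem orbitOf_line_swap (x y : ℂ) : orbitOf (line x y) = orbitOf (line y x) := by
  refine orbitOf_mk_eq _ _ (monomialMatrix_mem_hessianMonoid (-1) 1 0 0 0) (μ := -1) ?_
  simp [funext_iff, forall_fin_three, monomialMatrix_mulVec, modThree_neg, modThree_one,
    show (-2 + 1 : Fin 3) = 2 from rfl]

theorem orbitOf_line_orderNine {ν ν' : ℂ} (hν : orderOf ν = 9) (hν' : orderOf ν' = 9) :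
    orbitOf (line ν (ν ^ 2)) = orbitOf (line ν' (ν' ^ 2)) := by
  obtain ⟨r, hr₀, hr⟩ := exists_χ_eq_pow_three hν
  obtain ⟨r', hr₀', hr'⟩ := exists_χ_eq_pow_three hν'
  obtain rfl | rfl : r' = r ∨ r' = r + r := by
    clear * - hr₀ hr₀'
    decide +revert
  · exact orbitOf_line_eq_of_pow_three_eq (hr.trans hr'.symm)
      (by rw [pow_right_comm, pow_right_comm ν', hr, hr'])
  · rw [orbitOf_line_swap]
    refine orbitOf_line_eq_of_pow_three_eq ?_ ?_
    · rw [pow_right_comm, hr, hr', sq, χ_add]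
    · rw [pow_right_comm ν', hr, hr', χ_add]
      linear_combination -χ r * χ_pow_three r

theorem gaussianMatrix_mulVec_axis (b d : Fin 3) (x : ℂ) (i : Fin 3) :
    (gaussianMatrix 1 0 b 0 d 0 *ᵥ ![x, 1, 1]) i =
      gaussSum⁻¹ * if i + d = 0 then x + 2 * χ b else x - χ b := by
  rw [gaussianMatrix_mulVec, modThree_one, one_mul, sum_χ_quadratic_axis]
  simp

theorem orbitOf_axis_of_pow_three_eq_one {x : ℂ} (hx : x ^ 3 = 1) :
    orbitOf (line x 1) = orbitOf (line 0 0) := by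
  rw [orbitOf_line_eq_of_pow_three_eq (x' := 1) (by rw [hx, one_pow]) rfl]
  refine orbitOf_mk_eq _ _ (gaussianMatrix_mem_hessianMonoid 1 0 0 0 1 0)
    (μ := gaussSum⁻¹ * 3) ?_
  ext i
  fin_cases i <;> norm_num +decide [gaussianMatrix_mulVec_axis, χ_zero]

theorem orbitOf_axis_of_pow_three_eq_neg_eight {x : ℂ} (hx : x ^ 3 = -8) :
    orbitOf (line x 1) = orbitOf (line 0 1) := by
  rw [orbitOf_line_eq_of_pow_three_eq (x' := -2) (by rw [hx]; norm_num) rfl]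
  refine orbitOf_mk_eq _ _ (gaussianMatrix_mem_hessianMonoid 1 0 0 0 0 0)
    (μ := gaussSum⁻¹ * -3) ?_
  ext i
  fin_cases i <;> norm_num +decide [gaussianMatrix_mulVec_axis, χ_zero]

theorem orbitOf_axis_two_sub {x : ℂ} (hx : x ^ 2 - 2 * x - 2 = 0) :
    orbitOf (line x 1) = orbitOf (line (2 - x) 1) := by
  rw [orbitOf_line_eq_of_pow_three_eq (x := 2 - x) (x' := χ 2 * (2 - x))
    (by rw [mul_pow, χ_pow_three, one_mul]) rfl]
  refine orbitOf_mk_eq _ _ (gaussianMatrix_mem_hessianMonoid 1 0 1 0 0 0)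
    (μ := gaussSum⁻¹ * (x - ω)) ?_
  have ratio : x + 2 * ω = (x - ω) * (ω ^ 2 * (2 - x)) := by
    linear_combination ω ^ 2 * hx + (2 - x) * omega_pow_three + 2 * omega_sq
  simp [funext_iff, forall_fin_three, gaussianMatrix_mulVec_axis, χ_one, χ_two, ratio, mul_assoc]

theorem sqrt_three_sq : ((√3 : ℝ) : ℂ) ^ 2 = 3 := by
  exact_mod_cast Real.sq_sqrt (zero_le_three (α := ℝ))

theorem orbitOf_line_sqrt_three :
    orbitOf (line ((1 + (√3 : ℝ)) * ω ^ 2) ω) = orbitOf (line (1 + (√3 : ℝ)) 1) :=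
  orbitOf_line_eq_of_pow_three_eq
    (by rw [mul_pow, pow_right_comm, omega_pow_three, one_pow, mul_one])
    (by rw [omega_pow_three, one_pow])

theorem orbitOf_axis_of_pow_six {x : ℂ} (hx : x ^ 6 - 20 * x ^ 3 - 8 = 0) :
    orbitOf (line x 1) = orbitOf (line ((1 + (√3 : ℝ)) * ω ^ 2) ω) := by
  have hsq := sqrt_three_sq
  have roots : (x ^ 3 - (1 + (√3 : ℝ)) ^ 3) * (x ^ 3 - (1 - (√3 : ℝ)) ^ 3) = 0 := by
    linear_combination hx - (6 * x ^ 3 + (1 - ((√3 : ℝ) : ℂ) ^ 2) ^ 2 -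
      2 * (1 - ((√3 : ℝ) : ℂ) ^ 2) + 4) * hsq
  rw [orbitOf_line_sqrt_three]
  rcases mul_eq_zero.mp roots with h | h
  · exact orbitOf_line_eq_of_pow_three_eq (sub_eq_zero.mp h) rfl
  · rw [orbitOf_line_eq_of_pow_three_eq (sub_eq_zero.mp h) rfl,
      orbitOf_axis_two_sub (by linear_combination hsq)]
    congr 2
    ring

section Generic

variable {v : Fin 3 → ℂ} {hv : v ≠ 0}

theorem eq_scalar_of_not_isSpecialOrbit
    (h : ¬IsSpecialOrbit (orbitOf (Projectivization.mk ℂ v hv)))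
    {A : Matrix (Fin 3) (Fin 3) ℂ} (hA : A ∈ hessianMonoid) (hAv : Fixes A v) :
    ∃ c, A = monomialMatrix 1 0 0 0 c := by
  obtain ⟨s, t, a, b, c, rfl⟩ | ⟨s, a, b, c, d, e, rfl⟩ := hA
  · obtain ⟨rfl, rfl, rfl, rfl⟩ : s = 1 ∧ t = 0 ∧ a = 0 ∧ b = 0 :=
      not_imp_comm.mp (isSpecialOrbit_of_fixes_monomialMatrix hv · hAv) h
    exact ⟨c, rfl⟩
  · exact absurd (isSpecialOrbit_of_fixes_gaussianMatrix hv hAv) h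

theorem scalar_mulVec (c : Fin 3) (v : Fin 3 → ℂ) : monomialMatrix 1 0 0 0 c *ᵥ v = χ c • v := by
  ext i
  simp [monomialMatrix_mulVec, modThree_one]

theorem encard_orbit_of_not_isSpecialOrbit
    (h : ¬IsSpecialOrbit (orbitOf (Projectivization.mk ℂ v hv))) :
    (MulAction.orbit G25 (Projectivization.mk ℂ v hv)).encard = 216 := by
  refine encard_orbit_eq hv (F := {(1, 0, 0, 0)}) (K := ∅) (fun s t a b c => ?_)
    (fun s a b c d e => iff_of_false ?_ (Finset.notMem_empty _)) (n := 216) (by decide)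
  · simp only [Finset.mem_singleton, Prod.mk.injEq]
    refine ⟨fun hfix => not_imp_comm.mp (isSpecialOrbit_of_fixes_monomialMatrix hv · hfix) h, ?_⟩
    rintro ⟨rfl, rfl, rfl, rfl⟩
    exact ⟨χ c, scalar_mulVec c v⟩
  · exact fun hfix => h (isSpecialOrbit_of_fixes_gaussianMatrix hv hfix)

end Generic

/-- The plane `n₀ v₀ + n₁ v₁ + n₂ v₂ = 0` with normal vector `n`. -/
def normalPlane (n : Fin 3 → ℂ) : Submodule ℂ (Fin 3 → ℂ) :=
  LinearMap.ker (dotProductEquiv ℂ (Fin 3) n)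

theorem mem_normalPlane {n v : Fin 3 → ℂ} : v ∈ normalPlane n ↔ n ⬝ᵥ v = 0 := Iff.rfl

theorem finrank_normalPlane {n : Fin 3 → ℂ} (hn : n ≠ 0) :
    Module.finrank ℂ (normalPlane n) = 2 := by
  have h := Module.Dual.finrank_ker_add_one_of_ne_zero
    ((map_ne_zero_iff _ (dotProductEquiv ℂ (Fin 3)).injective).mpr hn)
  rw [Module.finrank_fin_fun] at h
  exact Nat.succ_injective h

theorem eq_normalPlane_of_le {P : Submodule ℂ (Fin 3 → ℂ)} (hP : Module.finrank ℂ P = 2)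
    {n : Fin 3 → ℂ} (hn : n ≠ 0) (h : P ≤ normalPlane n) : P = normalPlane n :=
  Submodule.eq_of_le_of_finrank_eq h (by rw [hP, finrank_normalPlane hn])

theorem mul_eq_mul_of_normalPlane_le {n m : Fin 3 → ℂ} (h : normalPlane n ≤ normalPlane m)
    (i j : Fin 3) : n i * m j = n j * m i := by
  have hmem := h (show n i • Pi.single j 1 - n j • Pi.single i 1 ∈ normalPlane n by
    rw [mem_normalPlane, dotProduct_sub, dotProduct_smul, dotProduct_smul,
      dotProduct_single_one, dotProduct_single_one]
    exact sub_eq_zero.mpr (mul_comm ..))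
  rw [mem_normalPlane, dotProduct_sub, dotProduct_smul, dotProduct_smul,
    dotProduct_single_one, dotProduct_single_one] at hmem
  exact sub_eq_zero.mp hmem

theorem normalPlane_smul (n : Fin 3 → ℂ) {x : ℂ} (hx : x ≠ 0) :
    normalPlane (x • n) = normalPlane n := by
  ext v
  simp [mem_normalPlane, hx]

/-- The indices of the twelve reflection planes. -/
abbrev ReflectionIndex : Type := Fin 3 ⊕ Fin 3 × Fin 3

/-- The normal vectors of the reflection planes: the standard basis vectors and the quadratic
phases. -/
def reflectionNormal : ReflectionIndex → Fin 3 → ℂ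
  | .inl i => Pi.single i 1
  | .inr (a, b) => fun j => χ (a * (j * j) + b * j)

theorem reflectionNormal_ne_zero (x : ReflectionIndex) : reflectionNormal x ≠ 0 := by
  obtain i | ⟨a, b⟩ := x
  · exact Pi.single_ne_zero_iff.mpr one_ne_zero
  · exact fun h => χ_ne_zero _ (congrFun h 0)

theorem normalPlane_reflectionNormal_injective :
    Function.Injective fun x => normalPlane (reflectionNormal x) := by
  have single_ne (i : Fin 3) (p : Fin 3 × Fin 3) :
      ¬normalPlane (reflectionNormal (.inl i)) ≤ normalPlane (reflectionNormal (.inr p)) :=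
    fun h => by
      have h' := mul_eq_mul_of_normalPlane_le h i (i + 1)
      simp [reflectionNormal, χ_ne_zero] at h'
  rintro (i | p) (j | q) h
  · by_contra hij
    have h' := mul_eq_mul_of_normalPlane_le h.le i j
    have hij : j ≠ i := fun hji => hij (hji ▸ rfl)
    simp [reflectionNormal, hij] at h'
  · exact absurd h.le (single_ne i q)
  · exact absurd h.ge (single_ne j p)
  · have h' (j : Fin 3) := mul_eq_mul_of_normalPlane_le h.le 0 j
    simp only [reflectionNormal, mul_zero, add_zero, χ_zero, one_mul, mul_one,
      χ_injective.eq_iff] at h'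
    have h₁ := h' 1
    have h₂ := h' 2
    congr 1
    clear * - h₁ h₂
    decide +revert

theorem exists_reflection_of_single (i : Fin 3) : ∃ A ∈ hessianMonoid, A ≠ 1 ∧
    ∀ v ∈ normalPlane (reflectionNormal (.inl i)), A *ᵥ v = v := by
  have phase (j : Fin 3) : -1 * (j * j) + 2 * i * j + (1 - i * i) = if j = i then 1 else 0 := by
    decide +revert
  have mulVec_apply (v : Fin 3 → ℂ) (j : Fin 3) :
      (monomialMatrix 1 0 (-1) (2 * i) (1 - i * i) *ᵥ v) j = (if j = i then ω else 1) * v j := by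
    rw [monomialMatrix_mulVec, phase, modThree_one, one_mul, add_zero, apply_ite χ, χ_one, χ_zero]
    simp
  refine ⟨_, monomialMatrix_mem_hessianMonoid 1 0 (-1) (2 * i) (1 - i * i), fun h => ?_,
    fun v hv => ?_⟩
  · have := mulVec_apply (Pi.single i 1) i
    simp [h, (isPrimitiveRoot_ω.ne_one (by norm_num)).symm] at this
  · have hvi : v i = 0 := by simpa [mem_normalPlane, reflectionNormal] using hv
    ext j
    rw [mulVec_apply]
    split_ifs with h
    · rw [h, hvi, mul_zero]
    · rw [one_mul]

theorem gaussianMatrix_apply_eq_one_apply_add (a b i j : Fin 3) :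
    gaussianMatrix 1 (1 - a) (a + 1) (-b) b 1 i j = (1 : Matrix (Fin 3) (Fin 3) ℂ) i j +
      gaussSum⁻¹ * χ (2 - a * (i * i) - b * i) * reflectionNormal (.inr (a, b)) j := by
  have phase : (1 - a) * (i * i) + modThree 1 * (i * j) + (a + 1) * (j * j) + -b * i + b * j + 1 =
      if i = j then 1 else 2 - a * (i * i) - b * i + (a * (j * j) + b * j) := by
    rw [modThree_one]
    decide +revert
  simp only [gaussianMatrix, of_apply, reflectionNormal, phase, one_apply]
  rw [mul_assoc, mul_assoc, ← χ_add]
  split_ifs with h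
  · rw [h, show 2 - a * (j * j) - b * j + (a * (j * j) + b * j) = 2 by ring, χ_one, χ_two]
    have := inv_mul_cancel₀ gaussSum_ne_zero
    rw [gaussSum] at this ⊢
    push_cast
    linear_combination this
  · simp

theorem exists_reflection_of_phase (p : Fin 3 × Fin 3) : ∃ A ∈ hessianMonoid, A ≠ 1 ∧
    ∀ v ∈ normalPlane (reflectionNormal (.inr p)), A *ᵥ v = v := by
  refine ⟨_, gaussianMatrix_mem_hessianMonoid 1 (1 - p.1) (p.1 + 1) (-p.2) p.2 1, fun h => ?_,
    fun v hv => funext fun i => ?_⟩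
  · rw [one_eq_monomialMatrix] at h
    exact monomialMatrix_ne_gaussianMatrix h.symm
  · have hv : ∑ j, reflectionNormal (.inr p) j * v j = 0 := hv
    simp only [mulVec, dotProduct, gaussianMatrix_apply_eq_one_apply_add, add_mul,
      Finset.sum_add_distrib, mul_assoc, ← Finset.mul_sum, hv, mul_zero, add_zero]
    exact congrFun (one_mulVec v) i

section Classification

variable {A : Matrix (Fin 3) (Fin 3) ℂ} {P : Submodule ℂ (Fin 3 → ℂ)}
  (hP : Module.finrank ℂ P = 2) (hfix : ∀ v ∈ P, A *ᵥ v = v)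

include hfix in
theorem le_normalPlane_sub_one (i : Fin 3) : P ≤ normalPlane ((A - 1) i) := fun v hv => by
  change ((A - 1) *ᵥ v) i = 0
  rw [sub_mulVec, one_mulVec, hfix v hv, sub_self, Pi.zero_apply]

include hP hfix

theorem eq_normalPlane_of_row_eq_smul {i : Fin 3} {n : Fin 3 → ℂ} (hn : n ≠ 0) {x : ℂ}
    (hx : x ≠ 0) (h : (A - 1) i = x • n) : P = normalPlane n :=
  eq_normalPlane_of_le hP hn
    (normalPlane_smul n hx ▸ h ▸ le_normalPlane_sub_one hfix i)

theorem sub_one_mul_eq_mul (i l j k : Fin 3) :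
    (A - 1) i j * (A - 1) l k = (A - 1) i k * (A - 1) l j := by
  by_cases hi : (A - 1) i = 0
  · have hi (m : Fin 3) : (A - 1) i m = 0 := congrFun hi m
    rw [hi, hi, zero_mul, zero_mul]
  · refine mul_eq_mul_of_normalPlane_le ?_ j k
    rw [← eq_normalPlane_of_le hP hi (le_normalPlane_sub_one hfix i)]
    exact le_normalPlane_sub_one hfix l

theorem exists_eq_normalPlane_of_monomialMatrix {s : ℤˣ} {t a b c : Fin 3}
    (hA : A = monomialMatrix s t a b c) (hne : A ≠ 1) :
    ∃ x, P = normalPlane (reflectionNormal x) := by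
  have entry (i j : Fin 3) : (A - 1) i j =
      (if j = modThree s * i + t then (s : ℂ) * χ (a * (i * i) + b * i + c) else 0) -
        if i = j then 1 else 0 := by rw [hA]; rfl
  by_cases hst : s = 1 ∧ t = 0
  · obtain ⟨rfl, rfl⟩ := hst
    have row (i : Fin 3) : (A - 1) i = (A - 1) i i • Pi.single i 1 := by
      ext j
      obtain rfl | hij := eq_or_ne j i
      · simp
      · simp [entry, modThree_one, hij, hij.symm]
    obtain ⟨i, hi⟩ : ∃ i, (A - 1) i i ≠ 0 := by
      by_contra! h
      refine hne (sub_eq_zero.mp (funext fun i => ?_))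
      rw [row, h, zero_smul]
      rfl
    exact ⟨.inl i, eq_normalPlane_of_row_eq_smul hP hfix (reflectionNormal_ne_zero (.inl i)) hi
      (row i)⟩
  · have diagonal_ne_zero (i : Fin 3) : (A - 1) i i ≠ 0 := by
      rw [entry, if_pos rfl]
      split_ifs with h
      · obtain rfl : s = -1 := by
          clear * - hst h
          decide +revert
        intro h'
        have hχ : χ (a * (i * i) + b * i + c) = -1 := by
          push_cast at h'
          linear_combination -h'
        have := χ_pow_three (a * (i * i) + b * i + c)
        norm_num [hχ] at this
      · norm_num
    obtain ⟨i, hi, hit⟩ : ∃ i : Fin 3, i ≠ 0 ∧ i ≠ t := by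
      clear * -
      decide +revert
    have minor := sub_one_mul_eq_mul hP hfix i 0 i 0
    rw [show (A - 1) 0 i = 0 by simp [entry, hi.symm, hit], mul_zero] at minor
    exact absurd minor (mul_ne_zero (diagonal_ne_zero i) (diagonal_ne_zero 0))

theorem exists_eq_normalPlane_of_gaussianMatrix {s : ℤˣ} {a b c d e : Fin 3}
    (hA : A = gaussianMatrix s a b c d e) : ∃ x, P = normalPlane (reflectionNormal x) := by
  have entry {i j : Fin 3} (hij : i ≠ j) : (A - 1) i j = s * gaussSum⁻¹ *
      χ (a * (i * i) + modThree s * (i * j) + b * (j * j) + c * i + d * j + e) := by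
    rw [Matrix.sub_apply, one_apply_ne hij, sub_zero, hA]
    rfl
  have hs : (s : ℂ) * gaussSum⁻¹ ≠ 0 := by
    simp [gaussSum_ne_zero]
  have corner : (A - 1) 0 0 = s * gaussSum⁻¹ * χ (e + modThree s) := by
    have minor := sub_one_mul_eq_mul hP hfix 0 1 0 2
    rw [entry (by decide : (1 : Fin 3) ≠ 2), entry (by decide : (0 : Fin 3) ≠ 2),
      entry (by decide : (1 : Fin 3) ≠ 0)] at minor
    refine mul_right_cancel₀ (mul_ne_zero hs (χ_ne_zero _)) (minor.trans ?_)
    simp only [mul_mul_mul_comm _ (χ _), ← χ_add]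
    congr 2
    linear_combination -modThree s * three_eq_zero
  refine ⟨.inr (b - modThree s, d), eq_normalPlane_of_row_eq_smul hP hfix
    (reflectionNormal_ne_zero _) (mul_ne_zero hs (χ_ne_zero (e + modThree s))) (i := 0) ?_⟩
  ext j
  rw [Pi.smul_apply, smul_eq_mul, reflectionNormal, mul_assoc, ← χ_add]
  obtain rfl | hj := eq_or_ne j 0
  · simpa using corner
  · rw [entry hj.symm]
    congr 2
    have hj : j * j = 1 := by
      clear * - hj
      decide +revert
    rw [hj]
    ring

end Classification

theorem isReflectionPlane_iff {P : Submodule ℂ (Fin 3 → ℂ)} :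
    IsReflectionPlane P ↔ ∃ x, normalPlane (reflectionNormal x) = P := by
  constructor
  · rintro ⟨hP, g, hg, hne, hfix⟩
    have hne : g.1 ≠ 1 := fun h => hne (Units.ext h)
    obtain ⟨s, t, a, b, c, h⟩ | ⟨s, a, b, c, d, e, h⟩ :=
      mem_hessianMonoid_iff.mp (coe_mem_hessianMonoid hg)
    · exact (exists_eq_normalPlane_of_monomialMatrix hP hfix h hne).imp fun _ => Eq.symm
    · exact (exists_eq_normalPlane_of_gaussianMatrix hP hfix h).imp fun _ => Eq.symm
  · rintro ⟨x, rfl⟩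
    obtain ⟨A, hA, hne, hfix⟩ : ∃ A ∈ hessianMonoid, A ≠ 1 ∧
        ∀ v ∈ normalPlane (reflectionNormal x), A *ᵥ v = v := by
      obtain i | p := x
      · exact exists_reflection_of_single i
      · exact exists_reflection_of_phase p
    obtain ⟨g, hg, rfl⟩ := exists_mem_G25_coe_eq hA
    exact ⟨finrank_normalPlane (reflectionNormal_ne_zero x), g, hg,
      fun h => hne (congrArg Units.val h), hfix⟩

theorem submodule_mk_le_iff {v : Fin 3 → ℂ} (hv : v ≠ 0) {P : Submodule ℂ (Fin 3 → ℂ)} :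
    (Projectivization.mk ℂ v hv).submodule ≤ P ↔ v ∈ P := by
  rw [Projectivization.submodule_mk, Submodule.span_singleton_le_iff_mem]

theorem numReflectionPlanes_mk {v : Fin 3 → ℂ} (hv : v ≠ 0) :
    numReflectionPlanes (Projectivization.mk ℂ v hv) =
      {x | reflectionNormal x ⬝ᵥ v = 0}.encard := by
  rw [numReflectionPlanes, ← normalPlane_reflectionNormal_injective.encard_image]
  congr 1
  ext P
  simp only [isReflectionPlane_iff, submodule_mk_le_iff, Set.mem_ofPred_eq, Set.mem_image]
  constructor
  · rintro ⟨⟨x, rfl⟩, h⟩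
    exact ⟨x, h, rfl⟩
  · rintro ⟨x, h, rfl⟩
    exact ⟨⟨x, rfl⟩, h⟩

theorem reflectionNormal_single_dotProduct (i : Fin 3) (v : Fin 3 → ℂ) :
    reflectionNormal (.inl i) ⬝ᵥ v = v i := by
  simp [reflectionNormal]

theorem reflectionNormal_phase_dotProduct (a b : Fin 3) (v : Fin 3 → ℂ) :
    reflectionNormal (.inr (a, b)) ⬝ᵥ v = v 0 + χ (a + b) * v 1 + χ (a + b * 2) * v 2 := by
  simp [dotProduct, Fin.sum_univ_three, reflectionNormal]

theorem isRegularVector_iff {v : Fin 3 → ℂ} :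
    IsRegularVector v ↔ ∀ x, reflectionNormal x ⬝ᵥ v ≠ 0 := by
  simp only [IsRegularVector, isReflectionPlane_iff, forall_exists_index, forall_apply_eq_imp_iff,
    mem_normalPlane, ne_eq]

theorem numReflectionPlanes_mk_eq_card {v : Fin 3 → ℂ} (hv : v ≠ 0) {F : Finset ReflectionIndex}
    (h : ∀ x, reflectionNormal x ⬝ᵥ v = 0 ↔ x ∈ F) :
    numReflectionPlanes (Projectivization.mk ℂ v hv) = F.card := by
  rw [numReflectionPlanes_mk, ← Set.encard_coe_eq_coe_finsetCard]
  exact congrArg Set.encard (Set.ext h)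

theorem IsRegularVector.numReflectionPlanes_eq_zero {v : Fin 3 → ℂ} (h : IsRegularVector v)
    (hv : v ≠ 0) : numReflectionPlanes (Projectivization.mk ℂ v hv) = 0 :=
  numReflectionPlanes_mk_eq_card hv (F := ∅) fun x =>
    iff_of_false (isRegularVector_iff.mp h x) (Finset.notMem_empty x)

theorem isRegularVector_axis {x : ℂ} (hx₀ : x ≠ 0) (hx₁ : x ^ 3 ≠ 1) (hx₂ : x ^ 3 ≠ -8) :
    IsRegularVector ![x, 1, 1] := by
  rw [isRegularVector_iff]
  rintro (i | ⟨a, b⟩)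
  · rw [reflectionNormal_single_dotProduct]
    fin_cases i <;> simp [hx₀]
  · have h := χ_pow_three a
    rw [reflectionNormal_phase_dotProduct, χ_add, χ_add, add_assoc]
    simp only [cons_val_zero, cons_val_one, cons_val, mul_one]
    rw [← mul_add, χ_add_χ_two_mul]
    split_ifs <;> intro h'
    · exact hx₂ (by rw [eq_neg_of_add_eq_zero_left h']; linear_combination -8 * h)
    · exact hx₁ (by rw [eq_neg_of_add_eq_zero_left h']; linear_combination h)

theorem isRegularVector_orderNine {ν : ℂ} (hν : orderOf ν = 9) :
    IsRegularVector ![ν, ν ^ 2, 1] := by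
  rw [isRegularVector_iff]
  rintro (i | ⟨a, b⟩)
  · rw [reflectionNormal_single_dotProduct]
    exact orderNine_apply_ne_zero (ne_zero_of_orderNine hν) i
  · rw [reflectionNormal_phase_dotProduct]
    intro h
    exact one_ne_zero (eq_zero_of_orderNine hν (χ_mem_adjoin (a + b * 2)) (one_mem _)
      (χ_mem_adjoin (a + b)) (Eq.trans (by simp; ring) h)).2.1

theorem isRegularVector_of_not_isSpecialOrbit {v : Fin 3 → ℂ} {hv : v ≠ 0}
    (h : ¬IsSpecialOrbit (orbitOf (Projectivization.mk ℂ v hv))) : IsRegularVector v := by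
  rintro P ⟨-, g, hg, hne, hfix⟩ hvP
  have hgv : g.1 *ᵥ v = v := hfix v hvP
  obtain ⟨c, hc⟩ :=
    eq_scalar_of_not_isSpecialOrbit h (coe_mem_hessianMonoid hg) ⟨1, by rw [hgv, one_smul]⟩
  obtain ⟨i, hi⟩ := Function.ne_iff.mp hv
  have hχ : χ c * v i = v i := by
    simpa [hc, monomialMatrix_mulVec, modThree_one] using congrFun hgv i
  obtain rfl := χ_eq_one_iff.mp (mul_eq_right₀ hi |>.mp hχ)
  exact hne (Units.ext (hc.trans one_eq_monomialMatrix.symm))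

theorem numReflectionPlanes_vertex : numReflectionPlanes (line 0 0) = 2 := by
  refine numReflectionPlanes_mk_eq_card _ (F := {.inl 0, .inl 1}) ?_
  rintro (i | ⟨a, b⟩)
  · rw [reflectionNormal_single_dotProduct]
    fin_cases i <;> simp
  · rw [reflectionNormal_phase_dotProduct]
    simp [χ_ne_zero]

theorem numReflectionPlanes_coordinate {x : ℂ} (hx₀ : x ≠ 0) (hx : x ^ 3 ≠ -1) :
    numReflectionPlanes (line 0 x) = 1 := by
  refine numReflectionPlanes_mk_eq_card _ (F := {.inl 0}) ?_
  rintro (i | ⟨a, b⟩)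
  · rw [reflectionNormal_single_dotProduct]
    fin_cases i <;> simp [hx₀]
  · refine iff_of_false (fun h => hx ?_) (by simp)
    have h : χ (a + b) * x = -χ (a + b * 2) := by
      rw [reflectionNormal_phase_dotProduct] at h
      simpa [add_eq_zero_iff_eq_neg] using h
    have h_cube : (χ (a + b) * x) ^ 3 = (-χ (a + b * 2)) ^ 3 := by rw [h]
    linear_combination h_cube - x ^ 3 * χ_pow_three (a + b) - χ_pow_three (a + b * 2)

theorem numReflectionPlanes_center : numReflectionPlanes (line 0 (-1)) = 4 := by
  refine numReflectionPlanes_mk_eq_card _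
    (F := {.inl 0, .inr (0, 0), .inr (1, 0), .inr (2, 0)}) ?_
  rintro (i | ⟨a, b⟩)
  · rw [reflectionNormal_single_dotProduct]
    fin_cases i <;> simp
  · have h : reflectionNormal (.inr (a, b)) ⬝ᵥ ![0, -1, 1] = 0 ↔ a + b * 2 = a + b := by
      rw [reflectionNormal_phase_dotProduct, ← χ_injective.eq_iff]
      simp [neg_add_eq_zero, eq_comm (a := χ (a + b))]
    rw [h]
    clear h
    decide +revert

theorem mem_smul_submodule_iff {g : GL (Fin 3) ℂ} {P : Submodule ℂ (Fin 3 → ℂ)} {v : Fin 3 → ℂ} :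
    v ∈ g • P ↔ g⁻¹ • v ∈ P :=
  ⟨fun ⟨w, hw, h⟩ => (inv_smul_eq_iff.mpr h.symm : g⁻¹ • v = w) ▸ hw,
    fun h => ⟨g⁻¹ • v, h, smul_inv_smul g v⟩⟩

theorem finrank_smul_submodule (g : GL (Fin 3) ℂ) (P : Submodule ℂ (Fin 3 → ℂ)) :
    Module.finrank ℂ ↥(g • P) = Module.finrank ℂ P :=
  (DistribMulAction.toLinearEquiv ℂ (Fin 3 → ℂ) g).finrank_map_eq P

theorem IsReflectionPlane.smul {P : Submodule ℂ (Fin 3 → ℂ)} (hP : IsReflectionPlane P)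
    {g : GL (Fin 3) ℂ} (hg : g ∈ G25) : IsReflectionPlane (g • P) := by
  obtain ⟨hrank, h, hh, hne, hfix⟩ := hP
  refine ⟨by rw [finrank_smul_submodule, hrank], g * h * g⁻¹,
    G25.mul_mem (G25.mul_mem hg hh) (G25.inv_mem hg), mt conj_eq_one_iff.mp hne, fun v hv => ?_⟩
  rw [mul_smul, mul_smul, hfix _ (mem_smul_submodule_iff.mp hv), smul_inv_smul]

theorem IsRegularVector.smul {v : Fin 3 → ℂ} (hv : IsRegularVector v) {g : GL (Fin 3) ℂ}
    (hg : g ∈ G25) : IsRegularVector (g • v) := fun P hP hmem =>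
  hv _ (hP.smul (G25.inv_mem hg)) (by rwa [mem_smul_submodule_iff, inv_inv])

theorem mem_eigenspace {g : GL (Fin 3) ℂ} {ζ : ℂ} {v : Fin 3 → ℂ} :
    v ∈ eigenspace g ζ ↔ g • v = ζ • v :=
  Module.End.mem_eigenspace_iff

theorem IsProperPlane.smul {E : Submodule ℂ (Fin 3 → ℂ)} (hE : IsProperPlane E)
    {g : GL (Fin 3) ℂ} (hg : g ∈ G25) : IsProperPlane (g • E) := by
  obtain ⟨h, hh, ζ, hζ, rfl, v, hvE, hv⟩ := hE
  refine ⟨g * h * g⁻¹, G25.mul_mem (G25.mul_mem hg hh) (G25.inv_mem hg), ζ, hζ, ?_, g • v,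
    Submodule.smul_mem_pointwise_smul v g _ hvE, hv.smul hg⟩
  ext w
  rw [mem_smul_submodule_iff, mem_eigenspace, mem_eigenspace, mul_smul, mul_smul,
    ← eq_inv_smul_iff (g := g), smul_comm g⁻¹ ζ w]

theorem encard_setOf_smul_submodule_le {Q : Submodule ℂ (Fin 3 → ℂ) → Prop}
    (hQ : ∀ g ∈ G25, ∀ P, Q P → Q (g • P)) (g : G25) (L : Line) :
    {P | Q P ∧ (g • L).submodule ≤ P}.encard = {P | Q P ∧ L.submodule ≤ P}.encard := by
  obtain ⟨g, hg⟩ := g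
  rw [← Set.encard_smul_set g {P | Q P ∧ L.submodule ≤ P}]
  congr 1
  ext P
  induction L using Projectivization.ind with | h v hv =>
  rw [Subgroup.smul_def, Projectivization.smul_mk, Set.mem_smul_set_iff_inv_smul_mem]
  simp only [Set.mem_ofPred_eq, submodule_mk_le_iff, mem_smul_submodule_iff, inv_inv]
  refine and_congr_left fun _ => ⟨hQ _ (G25.inv_mem hg) P, fun h => ?_⟩
  simpa only [smul_inv_smul] using hQ g hg _ h

theorem mem_orbitsOfType {L : Line} {n r p : ℕ∞} : orbitOf L ∈ orbitsOfType n r p ↔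
    (MulAction.orbit G25 L).encard = n ∧ numReflectionPlanes L = r ∧ numProperPlanes L = p := by
  refine and_congr_right fun _ => ⟨fun h => h L (MulAction.mem_orbit_self L), ?_⟩
  rintro ⟨rfl, rfl⟩ _ ⟨g, rfl⟩
  exact ⟨encard_setOf_smul_submodule_le (fun _ hg _ hP => hP.smul hg) g L,
    encard_setOf_smul_submodule_le (fun _ hg _ hE => hE.smul hg) g L⟩

/-- The normal vectors of the proper planes: the plane `v (k + 1) = ω ^ b * v (k + 2)` is the set of
vectors that are negated by `involution k b`. -/
def mirrorNormal (p : Fin 3 × Fin 3) : Fin 3 → ℂ :=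
  Pi.single (p.1 + 1) 1 - Pi.single (p.1 + 2) (χ p.2)

/-- The element of the group that negates `v k` and maps `v (k + 1)` to `-ω ^ b * v (k + 2)`. -/
def involution (k b : Fin 3) : Matrix (Fin 3) (Fin 3) ℂ :=
  monomialMatrix (-1) (2 * k) 0 b (2 * b * k)

theorem mem_normalPlane_mirrorNormal {k b : Fin 3} {v : Fin 3 → ℂ} :
    v ∈ normalPlane (mirrorNormal (k, b)) ↔ v (k + 1) = χ b * v (k + 2) := by
  rw [mem_normalPlane, mirrorNormal, sub_dotProduct, single_dotProduct, single_dotProduct, one_mul,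
    sub_eq_zero]

theorem normalPlane_mirrorNormal_injective :
    Function.Injective fun p => normalPlane (mirrorNormal p) := by
  rintro ⟨k, b⟩ ⟨l, c⟩ h
  have h := mul_eq_mul_of_normalPlane_le h.le
  have hkl : k = l := by
    have hzero : mirrorNormal (l, c) k = 0 := by simpa [mirrorNormal] using (h k (k + 1)).symm
    obtain rfl | rfl | rfl : k = l ∨ k = l + 1 ∨ k = l + 2 := by clear * -; decide +revert
    · rfl
    all_goals simp [mirrorNormal, χ_ne_zero] at hzero
  subst hkl
  have hbc : χ c = χ b := by simpa [mirrorNormal] using h (k + 1) (k + 2)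
  rw [χ_injective hbc]

theorem involution_mulVec_eq_neg_iff {k b : Fin 3} {v : Fin 3 → ℂ} :
    involution k b *ᵥ v = -v ↔ v ∈ normalPlane (mirrorNormal (k, b)) := by
  have entry (j : Fin 3) : (involution k b *ᵥ v) (k + j) = -(χ (b * j) * v (k + 2 * j)) := by
    rw [involution, monomialMatrix_mulVec, modThree_neg, modThree_one,
      show -1 * (k + j) + 2 * k = k + 2 * j by linear_combination -j * three_eq_zero,
      show 0 * ((k + j) * (k + j)) + b * (k + j) + 2 * b * k = b * j by
        linear_combination b * k * three_eq_zero]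
    simp
  have inverse : χ (b * 2) * χ b = 1 := by
    rw [← χ_add, χ_eq_one_iff]
    linear_combination b * three_eq_zero
  rw [mem_normalPlane_mirrorNormal, funext_iff, ← (Equiv.addLeft k).forall_congr_right]
  simp only [Equiv.coe_addLeft, entry, Pi.neg_apply, neg_inj, forall_fin_three, mul_zero, χ_zero,
    mul_one, one_mul, add_zero, true_and, show (2 * 2 : Fin 3) = 1 from rfl]
  exact ⟨fun h => h.1.symm, fun h => ⟨h.symm, by rw [h, ← mul_assoc, inverse, one_mul]⟩⟩

theorem eq_neg_one_of_monomialMatrix_mulVec_eq_neg {s : ℤˣ} {t a b c : Fin 3} {v : Fin 3 → ℂ}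
    (hv : ∀ i, v i ≠ 0) (h : monomialMatrix s t a b c *ᵥ v = -v) :
    s = -1 ∧ a = 0 ∧ c = b * t := by
  have entry (i : Fin 3) := congrFun h i
  simp only [monomialMatrix_mulVec, Pi.neg_apply] at entry
  obtain rfl | rfl := Int.units_eq_one_or s
  · have h_cube (i : Fin 3) : v (i + t) ^ 3 = -v i ^ 3 := by
      rw [← Odd.neg_pow (by decide), ← entry, mul_pow, mul_pow, χ_pow_three, modThree_one, one_mul]
      simp
    have h_cycle : v (0 + t + t + t) ^ 3 = -v 0 ^ 3 := by simp only [h_cube, neg_neg]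
    rw [show 0 + t + t + t = 0 by linear_combination t * three_eq_zero] at h_cycle
    exact absurd (self_eq_neg.mp h_cycle) (pow_ne_zero 3 (hv 0))
  · have swap (i : Fin 3) : χ (a * (i * i) + b * i + c) * v (-i + t) = v i := by
      simpa [modThree_neg, modThree_one] using entry i
    have phase (i : Fin 3) :
        a * ((-i + t) * (-i + t)) + b * (-i + t) + c + (a * (i * i) + b * i + c) = 0 := by
      rw [← χ_eq_one_iff, χ_add, ← mul_eq_right₀ (hv (-i + t)), mul_assoc, swap]
      simpa using swap (-i + t)
    clear * - phase
    refine ⟨rfl, ?_⟩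
    decide +revert

theorem IsRegularVector.apply_ne_zero {v : Fin 3 → ℂ} (hv : IsRegularVector v) (i : Fin 3) :
    v i ≠ 0 := by
  simpa only [reflectionNormal_single_dotProduct] using isRegularVector_iff.mp hv (.inl i)

theorem monomialMatrix_neg_one_mulVec_ne {t a b c : Fin 3} {v : Fin 3 → ℂ} (hv : ∀ i, v i ≠ 0) :
    monomialMatrix (-1) t a b c *ᵥ v ≠ v := fun h => by
  have entry := congrFun h (-t)
  rw [monomialMatrix_mulVec, modThree_neg, modThree_one,
    show -1 * -t + t = -t by linear_combination t * three_eq_zero,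
    mul_eq_right₀ (hv (-t))] at entry
  generalize a * (-t * -t) + b * -t + c = x at entry
  have h_cube := χ_pow_three x
  rw [show χ x = -1 by simpa [neg_eq_iff_eq_neg] using entry] at h_cube
  norm_num at h_cube

theorem exists_eq_involution_of_mulVec_eq_neg {A : Matrix (Fin 3) (Fin 3) ℂ}
    (hA : A ∈ hessianMonoid) {v : Fin 3 → ℂ} (hv : IsRegularVector v) (h : A *ᵥ v = -v) :
    ∃ k b, A = involution k b := by
  obtain ⟨s, t, a, b, c, rfl⟩ | ⟨s, a, b, c, d, e, rfl⟩ := hA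
  · obtain ⟨rfl, rfl, rfl⟩ := eq_neg_one_of_monomialMatrix_mulVec_eq_neg hv.apply_ne_zero h
    refine ⟨2 * t, b, ?_⟩
    rw [involution]
    congr 1
    · linear_combination -t * three_eq_zero
    · linear_combination -b * t * three_eq_zero
  exfalso
  by_cases hab : a + b = 0
  · have hsq : (gaussianMatrix s a b c d e * gaussianMatrix s a b c d e) *ᵥ v = v := by
      rw [← mulVec_mulVec, h, mulVec_neg, h, neg_neg]
    rw [gaussianMatrix_mul_gaussianMatrix_of_add_eq_zero (h := by rwa [add_comm]),
      Int.units_mul_self] at hsq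
    exact monomialMatrix_neg_one_mulVec_ne hv.apply_ne_zero hsq
  · obtain ⟨C, hC, s', t', a', b', c', ha', hCA⟩ :=
      exists_mul_gaussianMatrix_eq_monomialMatrix_mul hab
    obtain ⟨g, hg, rfl⟩ := exists_mem_G25_coe_eq hC
    have h' : monomialMatrix s' t' a' b' c' *ᵥ (g • v) = -(g • v) := by
      change _ *ᵥ (g.1 *ᵥ v) = -(g.1 *ᵥ v)
      rw [mulVec_mulVec, ← hCA, ← mulVec_mulVec, h, mulVec_neg]
    exact ha' (eq_neg_one_of_monomialMatrix_mulVec_eq_neg (hv.smul hg).apply_ne_zero h').2.1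

theorem isRegularVector_mirrorVector (k b : Fin 3) :
    IsRegularVector (monomialMatrix 1 (2 * k) 0 (2 * b) 0 *ᵥ ![2, 1, 1]) := by
  obtain ⟨g, hg, h⟩ :=
    exists_mem_G25_coe_eq (monomialMatrix_mem_hessianMonoid 1 (2 * k) 0 (2 * b) 0)
  rw [← h]
  exact (isRegularVector_axis (x := 2) (by norm_num) (by norm_num) (by norm_num)).smul hg

theorem mirrorVector_mem (k b : Fin 3) :
    monomialMatrix 1 (2 * k) 0 (2 * b) 0 *ᵥ ![2, 1, 1] ∈ normalPlane (mirrorNormal (k, b)) := by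
  have index₁ : 1 * (k + 1) + 2 * k = 1 := by linear_combination k * three_eq_zero
  have index₂ : 1 * (k + 2) + 2 * k = 2 := by linear_combination k * three_eq_zero
  rw [mem_normalPlane_mirrorNormal, monomialMatrix_mulVec, monomialMatrix_mulVec, modThree_one,
    index₁, index₂]
  simp only [zero_mul, zero_add, add_zero, cons_val_one, cons_val, mul_one, Units.val_one,
    Int.cast_one, one_mul, ← χ_add]
  congr 1
  linear_combination -b * three_eq_zero

theorem orderOf_neg_ω : orderOf (-ω) = 6 := by
  have h := isPrimitiveRoot_ω.eq_orderOf
  have h₂ : orderOf (-1 : ℂ) = 2 := by rw [orderOf_neg_one]; simp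
  rw [neg_eq_neg_one_mul, (Commute.all _ _).orderOf_mul_eq_mul_orderOf_of_coprime
    (by rw [h₂, ← h]; decide), h₂, ← h]

theorem exists_eq_neg_χ_of_orderOf {ζ : ℂ} (hζ : orderOf ζ = 6) : ∃ c, ζ = -χ c := by
  have h₆ : (ζ ^ 3 - 1) * (ζ ^ 3 + 1) = 0 := by
    linear_combination orderOf_dvd_iff_pow_eq_one.mp (dvd_of_eq hζ)
  have h₃ : ζ ^ 3 - 1 ≠ 0 := fun h => by
    have := orderOf_dvd_of_pow_eq_one (sub_eq_zero.mp h)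
    rw [hζ] at this
    exact absurd this (by decide)
  obtain ⟨c, hc⟩ := exists_χ_eq (x := -ζ)
    (by linear_combination -(mul_eq_zero.mp h₆).resolve_left h₃)
  exact ⟨c, by rw [hc, neg_neg]⟩

theorem isProperPlane_iff {E : Submodule ℂ (Fin 3 → ℂ)} :
    IsProperPlane E ↔ ∃ p, normalPlane (mirrorNormal p) = E := by
  constructor
  · rintro ⟨g, hg, ζ, hζ, rfl, v, hvE, hv⟩
    obtain ⟨c, rfl⟩ := exists_eq_neg_χ_of_orderOf hζ
    have rescale (w : Fin 3 → ℂ) : w ∈ eigenspace g (-χ c) ↔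
        (monomialMatrix 1 0 0 0 (-c) * g.1) *ᵥ w = -w := by
      have cancel : χ (-c) * χ c = 1 := by rw [← χ_add, neg_add_cancel, χ_zero]
      rw [mem_eigenspace, ← mulVec_mulVec, scalar_mulVec,
        ← (smul_right_injective (Fin 3 → ℂ) (χ_ne_zero (-c))).eq_iff, neg_smul, smul_neg,
        smul_smul, cancel, one_smul]
      rfl
    obtain ⟨k, b, h⟩ := exists_eq_involution_of_mulVec_eq_neg (hessianMonoid.mul_mem
      (monomialMatrix_mem_hessianMonoid 1 0 0 0 (-c)) (coe_mem_hessianMonoid hg)) hv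
      ((rescale v).mp hvE)
    exact ⟨(k, b), Submodule.ext fun w => by rw [rescale, h, involution_mulVec_eq_neg_iff]⟩
  · rintro ⟨⟨k, b⟩, rfl⟩
    obtain ⟨g, hg, h⟩ := exists_mem_G25_coe_eq (hessianMonoid.mul_mem
      (monomialMatrix_mem_hessianMonoid 1 0 0 0 1)
      (monomialMatrix_mem_hessianMonoid (-1) (2 * k) 0 b (2 * b * k)))
    refine ⟨g, hg, -ω, orderOf_neg_ω, Submodule.ext fun w => ?_, _, mirrorVector_mem k b,
      isRegularVector_mirrorVector k b⟩
    rw [mem_eigenspace, ← involution_mulVec_eq_neg_iff]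
    change _ ↔ g.1 *ᵥ w = _
    rw [h, ← mulVec_mulVec, scalar_mulVec, χ_one, neg_smul, ← smul_neg]
    exact (smul_right_injective _ (χ_one ▸ χ_ne_zero 1)).eq_iff.symm

theorem numProperPlanes_mk {v : Fin 3 → ℂ} (hv : v ≠ 0) :
    numProperPlanes (Projectivization.mk ℂ v hv) =
      {p : Fin 3 × Fin 3 | v (p.1 + 1) = χ p.2 * v (p.1 + 2)}.encard := by
  rw [← normalPlane_mirrorNormal_injective.encard_image]
  refine congrArg Set.encard (Set.ext fun E => ?_)
  rw [Set.mem_ofPred_eq, isProperPlane_iff, submodule_mk_le_iff]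
  constructor
  · rintro ⟨⟨p, rfl⟩, h⟩
    exact ⟨p, mem_normalPlane_mirrorNormal.mp h, rfl⟩
  · rintro ⟨p, h, rfl⟩
    exact ⟨⟨p, rfl⟩, mem_normalPlane_mirrorNormal.mpr h⟩

theorem numProperPlanes_mk_eq_card {v : Fin 3 → ℂ} (hv : v ≠ 0) {F : Finset (Fin 3 × Fin 3)}
    (h : ∀ k b, v (k + 1) = χ b * v (k + 2) ↔ (k, b) ∈ F) :
    numProperPlanes (Projectivization.mk ℂ v hv) = F.card := by
  rw [numProperPlanes_mk, ← Set.encard_coe_eq_coe_finsetCard]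
  exact congrArg Set.encard (Set.ext fun p => h p.1 p.2)

theorem numProperPlanes_line_eq_card {x y : ℂ} {F : Finset (Fin 3 × Fin 3)}
    (h₀ : ∀ b, y = χ b ↔ (0, b) ∈ F) (h₁ : ∀ b, 1 = χ b * x ↔ (1, b) ∈ F)
    (h₂ : ∀ b, x = χ b * y ↔ (2, b) ∈ F) : numProperPlanes (line x y) = F.card :=
  numProperPlanes_mk_eq_card _ fun
    | 0, b => by simpa using h₀ b
    | 1, b => h₁ b
    | 2, b => h₂ b

theorem numProperPlanes_vertex : numProperPlanes (line 0 0) = 3 :=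
  numProperPlanes_line_eq_card (F := {(2, 0), (2, 1), (2, 2)})
    (fun b => iff_of_false (χ_ne_zero b).symm (by simp)) (fun b => by simp)
    (fun b => iff_of_true (by simp) (by decide +revert))

theorem numProperPlanes_coordinate {x : ℂ} (hx₀ : x ≠ 0) (hx : x ^ 3 ≠ 1) :
    numProperPlanes (line 0 x) = 0 :=
  numProperPlanes_line_eq_card (F := ∅)
    (fun b => iff_of_false (fun h => hx (by rw [h, χ_pow_three])) (by simp))
    (fun b => by simp) (fun b => by simp [χ_ne_zero, hx₀])

theorem numProperPlanes_mirrorCenter : numProperPlanes (line 0 1) = 1 :=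
  numProperPlanes_line_eq_card (F := {(0, 0)})
    (fun b => by simp [eq_comm (a := (1 : ℂ)), χ_eq_one_iff])
    (fun b => by simp) (fun b => by simp [(χ_ne_zero b).symm])

theorem numProperPlanes_axis {x : ℂ} (hx : x ^ 3 ≠ 1) : numProperPlanes (line x 1) = 1 :=
  numProperPlanes_line_eq_card (F := {(0, 0)})
    (fun b => by simp [eq_comm (a := (1 : ℂ)), χ_eq_one_iff])
    (fun b => iff_of_false (fun h => hx (by
      rw [← one_mul (x ^ 3), ← χ_pow_three b, ← mul_pow, ← h, one_pow, χ_pow_three])) (by simp))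
    (fun b => iff_of_false (fun h => hx (by rw [h, mul_one, χ_pow_three])) (by simp))

theorem numProperPlanes_orderNine {ν : ℂ} (hν : orderOf ν = 9) :
    numProperPlanes (line ν (ν ^ 2)) = 0 := by
  obtain ⟨r, hr₀, hr⟩ := exists_χ_eq_pow_three hν
  refine numProperPlanes_mk_eq_card _ (F := ∅) fun k b => iff_of_false (fun h => hr₀ ?_) (by simp)
  have h_cube : ![ν, ν ^ 2, 1] (k + 1) ^ 3 = ![ν, ν ^ 2, 1] (k + 2) ^ 3 := by
    rw [h, mul_pow, χ_pow_three, one_mul]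
  rw [orderNine_apply_pow_three hr, orderNine_apply_pow_three hr, χ_injective.eq_iff] at h_cube
  linear_combination -h_cube

theorem numProperPlanes_of_not_isSpecialOrbit {v : Fin 3 → ℂ} {hv : v ≠ 0}
    (h : ¬IsSpecialOrbit (orbitOf (Projectivization.mk ℂ v hv))) :
    numProperPlanes (Projectivization.mk ℂ v hv) = 0 := by
  refine numProperPlanes_mk_eq_card _ (F := ∅) fun k b => iff_of_false (fun hmem => ?_) (by simp)
  have hneg := involution_mulVec_eq_neg_iff.mpr (mem_normalPlane_mirrorNormal.mpr hmem)
  obtain ⟨c, hc⟩ := eq_scalar_of_not_isSpecialOrbit h (monomialMatrix_mem_hessianMonoid ..)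
    ⟨-1, by rw [neg_one_smul]; exact hneg⟩
  exact absurd (monomialMatrix_inj hc).1 (by decide)

/-- The rows of the table of orbits: `OrbitRow n r p O` says that `O` is one of the orbits that make
up the row with size `n`, with `r` reflection planes and with `p` proper planes. -/
inductive OrbitRow : ℕ → ℕ → ℕ → LineOrbit → Prop
  | generic {O : LineOrbit} (h : ¬IsSpecialOrbit O) : OrbitRow 216 0 0 O
  | orderNine {ν : ℂ} (hν : orderOf ν = 9) : OrbitRow 72 0 0 (orbitOf (line ν (ν ^ 2)))
  | axis {x : ℂ} (hx₀ : x ≠ 0) (hx₁ : x ^ 3 ≠ 1) (hx₂ : x ^ 3 ≠ -8)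
      (hx₃ : x ^ 6 - 20 * x ^ 3 - 8 ≠ 0) : OrbitRow 108 0 1 (orbitOf (line x 1))
  | sqrtThree : OrbitRow 54 0 1 (orbitOf (line ((1 + (√3 : ℝ)) * ω ^ 2) ω))
  | coordinate {x : ℂ} (hx₀ : x ≠ 0) (hx : x ^ 6 ≠ 1) : OrbitRow 72 1 0 (orbitOf (line 0 x))
  | mirrorCenter : OrbitRow 36 1 1 (orbitOf (line 0 1))
  | vertex : OrbitRow 12 2 3 (orbitOf (line 0 0))
  | center : OrbitRow 9 4 0 (orbitOf (line 0 (-1)))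

theorem OrbitRow.mem_orbitsOfType {n r p : ℕ} {O : LineOrbit} (h : OrbitRow n r p O) :
    O ∈ orbitsOfType n r p := by
  cases h with
  | generic h =>
    induction O using Quotient.inductionOn' with | h L =>
    induction L using Projectivization.ind with | h v hv =>
    exact Hessian.mem_orbitsOfType.mpr ⟨encard_orbit_of_not_isSpecialOrbit h,
      (isRegularVector_of_not_isSpecialOrbit h).numReflectionPlanes_eq_zero hv,
      numProperPlanes_of_not_isSpecialOrbit h⟩
  | orderNine hν =>
    exact Hessian.mem_orbitsOfType.mpr ⟨encard_orbit_orderNine hν,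
      (isRegularVector_orderNine hν).numReflectionPlanes_eq_zero _, numProperPlanes_orderNine hν⟩
  | axis hx₀ hx₁ hx₂ hx₃ =>
    exact Hessian.mem_orbitsOfType.mpr ⟨encard_orbit_axis hx₀ hx₁ hx₂ hx₃,
      (isRegularVector_axis hx₀ hx₁ hx₂).numReflectionPlanes_eq_zero _, numProperPlanes_axis hx₁⟩
  | sqrtThree =>
    have hx : (1 + (√3 : ℝ) : ℂ) ^ 2 - 2 * (1 + (√3 : ℝ)) - 2 = 0 := by
      linear_combination sqrt_three_sq
    obtain ⟨hx₀, hx₁, hx₂⟩ := axis_ne_of_quadratic hx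
    rw [orbitOf_line_sqrt_three]
    exact Hessian.mem_orbitsOfType.mpr ⟨encard_orbit_axis_of_quadratic hx,
      (isRegularVector_axis hx₀ hx₁ hx₂).numReflectionPlanes_eq_zero _, numProperPlanes_axis hx₁⟩
  | coordinate hx₀ hx =>
    exact Hessian.mem_orbitsOfType.mpr ⟨encard_orbit_coordinate hx₀ hx,
      numReflectionPlanes_coordinate hx₀ fun h => hx (by linear_combination (_ ^ 3 - 1) * h),
      numProperPlanes_coordinate hx₀ fun h => hx (by linear_combination (_ ^ 3 + 1) * h)⟩
  | mirrorCenter =>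
    exact Hessian.mem_orbitsOfType.mpr ⟨encard_orbit_mirrorCenter,
      numReflectionPlanes_coordinate one_ne_zero (by norm_num), numProperPlanes_mirrorCenter⟩
  | vertex =>
    exact Hessian.mem_orbitsOfType.mpr
      ⟨encard_orbit_vertex, numReflectionPlanes_vertex, numProperPlanes_vertex⟩
  | center =>
    exact Hessian.mem_orbitsOfType.mpr ⟨encard_orbit_center, numReflectionPlanes_center,
      numProperPlanes_coordinate (neg_ne_zero.mpr one_ne_zero) (by norm_num)⟩

theorem exists_orbitRow_coordinate (x : ℂ) : ∃ n r p, OrbitRow n r p (orbitOf (line 0 x)) := by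
  obtain rfl | hx₀ := eq_or_ne x 0
  · exact ⟨_, _, _, .vertex⟩
  obtain h | hx₁ := eq_or_ne (x ^ 3) 1
  · rw [orbitOf_line_eq_of_pow_three_eq (y' := 1) rfl (by rw [h, one_pow])]
    exact ⟨_, _, _, .mirrorCenter⟩
  obtain h | hx₂ := eq_or_ne (x ^ 3) (-1)
  · rw [orbitOf_line_eq_of_pow_three_eq (y' := -1) rfl (by rw [h]; norm_num)]
    exact ⟨_, _, _, .center⟩
  · refine ⟨_, _, _, .coordinate hx₀ fun h => ?_⟩
    have h : (x ^ 3) ^ 2 = 1 := by rw [← pow_mul, h]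
    exact (sq_eq_one_iff.mp h).elim hx₁ hx₂

theorem exists_orbitRow_axis (x : ℂ) : ∃ n r p, OrbitRow n r p (orbitOf (line x 1)) := by
  obtain rfl | hx₀ := eq_or_ne x 0
  · exact ⟨_, _, _, .mirrorCenter⟩
  obtain hx₁ | hx₁ := eq_or_ne (x ^ 3) 1
  · rw [orbitOf_axis_of_pow_three_eq_one hx₁]
    exact ⟨_, _, _, .vertex⟩
  obtain hx₂ | hx₂ := eq_or_ne (x ^ 3) (-8)
  · rw [orbitOf_axis_of_pow_three_eq_neg_eight hx₂]
    exact ⟨_, _, _, .mirrorCenter⟩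
  obtain hx₃ | hx₃ := eq_or_ne (x ^ 6 - 20 * x ^ 3 - 8) 0
  · rw [orbitOf_axis_of_pow_six hx₃]
    exact ⟨_, _, _, .sqrtThree⟩
  · exact ⟨_, _, _, .axis hx₀ hx₁ hx₂ hx₃⟩

theorem exists_orbitRow (O : LineOrbit) : ∃ n r p, OrbitRow n r p O := by
  by_cases h : IsSpecialOrbit O
  · cases h with
    | coordinate x => exact exists_orbitRow_coordinate x
    | axis x => exact exists_orbitRow_axis x
    | orderNine hν => exact ⟨_, _, _, .orderNine hν⟩
  · exact ⟨_, _, _, .generic h⟩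

theorem mem_orbitsOfType_iff_orbitRow {n r p : ℕ} {O : LineOrbit} :
    O ∈ orbitsOfType n r p ↔ OrbitRow n r p O := by
  refine ⟨fun h => ?_, OrbitRow.mem_orbitsOfType⟩
  obtain ⟨n', r', p', h'⟩ := exists_orbitRow O
  induction O using Quotient.inductionOn' with | h L =>
  obtain ⟨hn, hr, hp⟩ := mem_orbitsOfType.mp h
  obtain ⟨hn', hr', hp'⟩ := mem_orbitsOfType.mp h'.mem_orbitsOfType
  rwa [Nat.cast_inj.mp (hn.symm.trans hn'), Nat.cast_inj.mp (hr.symm.trans hr'),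
    Nat.cast_inj.mp (hp.symm.trans hp')]

theorem encard_orbitsOfType_eq_one {n r p : ℕ} {O : LineOrbit} (hO : OrbitRow n r p O)
    (h : ∀ O', OrbitRow n r p O' → O' = O) : (orbitsOfType n r p).encard = 1 :=
  Set.encard_eq_one.mpr ⟨O, Set.eq_singleton_iff_unique_mem.mpr
    ⟨hO.mem_orbitsOfType, fun O' hO' => h O' (mem_orbitsOfType_iff_orbitRow.mp hO')⟩⟩

section KrullDimension

variable {X : Type*} [TopologicalSpace X] [T1Space X]

theorem topologicalKrullDim_eq_one_of_finite [Infinite X]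
    (h : ∀ C : Set X, IsClosed C → C ≠ Set.univ → C.Finite) : topologicalKrullDim X = 1 := by
  apply le_antisymm
  · rw [topologicalKrullDim, Order.krullDim_le_one_iff]
    intro Z
    by_cases hZ : (Z : Set X) = Set.univ
    · exact Or.inr fun Y _ => (hZ ▸ Set.subset_univ _ : (Y : Set X) ⊆ Z)
    · refine Or.inl fun Y hY x hx => ?_
      have hsub : (Z : Set X).Subsingleton :=
        (h _ Z.isClosed' hZ).isDiscrete.subsingleton_of_isPreirreducible Z.isIrreducible'.2
      obtain ⟨y, hy⟩ := Y.isIrreducible'.nonempty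
      rwa [hsub hx (hY hy)]
  · have irreducible : IsIrreducible (Set.univ : Set X) := by
      refine ⟨Set.univ_nonempty, isPreirreducible_iff_isClosed_union_isClosed.mpr
        fun C D hC hD hCD => ?_⟩
      by_contra! hne
      exact Set.infinite_univ (((h C hC fun h => hne.1 h.ge).union
        (h D hD fun h => hne.2 h.ge)).subset hCD)
    obtain ⟨x⟩ : Nonempty X := inferInstance
    refine Order.one_le_krullDim_iff.mpr ⟨⟨{x}, isIrreducible_singleton, isClosed_singleton⟩,
      ⟨Set.univ, irreducible, isClosed_univ⟩, ?_⟩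
    have hx : ({x} : Set X) ⊂ Set.univ :=
      (Set.subset_univ _).ssubset_of_ne fun he => Set.infinite_univ (he ▸ Set.finite_singleton x)
    exact hx

theorem topologicalKrullDim_eq_one_of_subset_range {α : Type*} {f : CofiniteTopology α → X}
    (hf : Continuous f) {S : Set X} (hS : S ⊆ Set.range f) (hinf : S.Infinite) :
    topologicalKrullDim S = 1 := by
  have := hinf.to_subtype
  refine topologicalKrullDim_eq_one_of_finite fun C hC hne => ?_
  obtain ⟨D, hD, rfl⟩ := isClosed_induced_iff.mp hC
  obtain h | h := CofiniteTopology.isClosed_iff.mp (hD.preimage hf)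
  · refine absurd (Set.eq_univ_of_forall fun ⟨x, hx⟩ => ?_) hne
    obtain ⟨a, rfl⟩ := hS hx
    exact (h.ge (Set.mem_univ a) :)
  · refine ((h.image f).subset ?_).preimage Subtype.val_injective.injOn |>.subset
      (s := Subtype.val ⁻¹' (D ∩ S)) fun x hx => ⟨hx, x.2⟩
    rintro x ⟨hxD, hxS⟩
    obtain ⟨a, rfl⟩ := hS hxS
    exact ⟨a, hxD, rfl⟩

end KrullDimension

section Zariski

theorem eval_smul_of_isHomogeneous {σ R : Type*} [CommSemiring R] {F : MvPolynomial σ R} {d : ℕ}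
    (hF : F.IsHomogeneous d) (c : R) (v : σ → R) :
    MvPolynomial.eval (c • v) F = c ^ d * MvPolynomial.eval v F := by
  rw [MvPolynomial.eval_eq, MvPolynomial.eval_eq, Finset.mul_sum]
  refine Finset.sum_congr rfl fun m hm => ?_
  have degree_eq : ∑ i ∈ m.support, m i = d := by
    rw [← hF (MvPolynomial.mem_support_iff.mp hm)]
    exact (DFunLike.congr_fun Finsupp.degree_eq_weight_one m :)
  simp only [Pi.smul_apply, smul_eq_mul, mul_pow, Finset.prod_mul_distrib,
    Finset.prod_pow_eq_pow_sum, degree_eq]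
  ring

/-- The basic Zariski open set of the lines on which a homogeneous polynomial does not vanish. -/
def nonvanishing (F : MvPolynomial (Fin 3) ℂ) : Set Line :=
  {L | ∃ v ∈ L.submodule, MvPolynomial.eval v F ≠ 0}

variable {F : MvPolynomial (Fin 3) ℂ} {d e : ℕ}

theorem isOpen_nonvanishing (hF : F.IsHomogeneous d) : IsOpen (nonvanishing F) :=
  TopologicalSpace.isOpen_generateFrom_of_mem ⟨d, F, hF, rfl⟩

theorem mk_mem_nonvanishing (hF : F.IsHomogeneous d) {v : Fin 3 → ℂ} (hv : v ≠ 0) :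
    Projectivization.mk ℂ v hv ∈ nonvanishing F ↔ MvPolynomial.eval v F ≠ 0 := by
  rw [nonvanishing, Set.mem_ofPred_eq, Projectivization.submodule_mk]
  refine ⟨?_, fun h => ⟨v, Submodule.mem_span_singleton_self v, h⟩⟩
  rintro ⟨w, hw, h⟩
  obtain ⟨c, rfl⟩ := Submodule.mem_span_singleton.mp hw
  rw [eval_smul_of_isHomogeneous hF] at h
  exact right_ne_zero_of_mul h

theorem nonvanishing_mul {G : MvPolynomial (Fin 3) ℂ} (hF : F.IsHomogeneous d)
    (hG : G.IsHomogeneous e) : nonvanishing (F * G) = nonvanishing F ∩ nonvanishing G := by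
  ext L
  induction L using Projectivization.ind with | h v hv =>
  rw [Set.mem_inter_iff, mk_mem_nonvanishing (hF.mul hG), mk_mem_nonvanishing hF,
    mk_mem_nonvanishing hG, map_mul, mul_ne_zero_iff]

theorem exists_nonvanishing_subset {U : Set Line} (hU : IsOpen U) {L : Line} (hL : L ∈ U) :
    ∃ (d : ℕ) (F : MvPolynomial (Fin 3) ℂ), F.IsHomogeneous d ∧ L ∈ nonvanishing F ∧
      nonvanishing F ⊆ U := by
  induction hU with
  | basic U h =>
    obtain ⟨d, F, hF, rfl⟩ := h
    exact ⟨d, F, hF, hL, subset_rfl⟩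
  | univ =>
    exact ⟨0, 1, MvPolynomial.isHomogeneous_one _ _, ⟨0, zero_mem _, by simp⟩, Set.subset_univ _⟩
  | inter U V _ _ ihU ihV =>
    obtain ⟨d, F, hF, hFL, hFU⟩ := ihU hL.1
    obtain ⟨e, G, hG, hGL, hGV⟩ := ihV hL.2
    refine ⟨d + e, F * G, hF.mul hG, ?_⟩
    rw [nonvanishing_mul hF hG]
    exact ⟨⟨hFL, hGL⟩, Set.inter_subset_inter hFU hGV⟩
  | sUnion S _ ih =>
    obtain ⟨U, hUS, hLU⟩ := hL
    obtain ⟨d, F, hF, hFL, hFU⟩ := ih U hUS hLU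
    exact ⟨d, F, hF, hFL, hFU.trans (Set.subset_sUnion_of_mem hUS)⟩

theorem nonvanishing_nonempty (hF : F.IsHomogeneous d) (hF₀ : F ≠ 0) :
    (nonvanishing F).Nonempty := by
  obtain ⟨v, hv⟩ : ∃ v, MvPolynomial.eval v (F * MvPolynomial.X 0) ≠ 0 := by
    by_contra! h
    exact mul_ne_zero hF₀ (MvPolynomial.X_ne_zero 0) (MvPolynomial.funext (by simpa using h))
  rw [map_mul, MvPolynomial.eval_X, mul_ne_zero_iff] at hv
  exact ⟨.mk ℂ v fun h => hv.2 (congrFun h 0), (mk_mem_nonvanishing hF _).mpr hv.1⟩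

instance preirreducibleSpace_line : PreirreducibleSpace Line := by
  refine .of_forall_nonempty_inter fun U V hU hV ⟨L, hL⟩ ⟨M, hM⟩ => ?_
  obtain ⟨d, F, hF, ⟨v, -, hv⟩, hFU⟩ := exists_nonvanishing_subset hU hL
  obtain ⟨e, G, hG, ⟨w, -, hw⟩, hGV⟩ := exists_nonvanishing_subset hV hM
  have hFG : F * G ≠ 0 := mul_ne_zero (fun h => hv (by simp [h])) (fun h => hw (by simp [h]))
  exact (nonvanishing_mul hF hG ▸ nonvanishing_nonempty (hF.mul hG) hFG).mono
    (Set.inter_subset_inter hFU hGV)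

theorem isOpen_of_mk_mem_iff_crossProduct {P Q : Fin 3 → MvPolynomial (Fin 3) ℂ}
    (hP : ∀ i, (P i).IsHomogeneous d) (hQ : ∀ i, (Q i).IsHomogeneous e) {U : Set Line}
    (hU : ∀ v hv, Projectivization.mk ℂ v hv ∈ U ↔
      (fun i => MvPolynomial.eval v (P i)) ⨯₃ (fun i => MvPolynomial.eval v (Q i)) ≠ 0) :
    IsOpen U := by
  have homogeneous (i j : Fin 3) : (P i * Q j - P j * Q i).IsHomogeneous (d + e) :=
    ((hP i).mul (hQ j)).sub ((hP j).mul (hQ i))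
  have : U = nonvanishing (P 1 * Q 2 - P 2 * Q 1) ∪ nonvanishing (P 2 * Q 0 - P 0 * Q 2) ∪
      nonvanishing (P 0 * Q 1 - P 1 * Q 0) := by
    ext L
    induction L using Projectivization.ind with | h v hv =>
    simp only [hU, Set.mem_union, mk_mem_nonvanishing (homogeneous _ _), cross_apply, Ne,
      map_sub, map_mul, funext_iff, forall_fin_three, not_and_or]
    simp [or_assoc]
  rw [this]
  exact (((isOpen_nonvanishing (homogeneous _ _)).union
    (isOpen_nonvanishing (homogeneous _ _))).union (isOpen_nonvanishing (homogeneous _ _)))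

instance t1Space_line : T1Space Line where
  t1 L := by
    induction L using Projectivization.ind with | h w hw =>
    refine isOpen_compl_iff.mp (isOpen_of_mk_mem_iff_crossProduct (P := MvPolynomial.X)
      (Q := fun i => MvPolynomial.C (w i)) (fun i => MvPolynomial.isHomogeneous_X _ i)
      (fun i => MvPolynomial.isHomogeneous_C _ (w i)) fun v hv => ?_)
    simp only [Set.mem_compl_singleton_iff, Ne,
      Projectivization.mk_eq_mk_iff_crossProduct_eq_zero hv hw, MvPolynomial.eval_X,
      MvPolynomial.eval_C]

theorem isOpen_setOf_smul_ne (g : GL (Fin 3) ℂ) : IsOpen {L : Line | g • L ≠ L} := by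
  refine isOpen_of_mk_mem_iff_crossProduct (P := (g : Matrix (Fin 3) (Fin 3) ℂ).toMvPolynomial)
    (Q := MvPolynomial.X) (fun i => toMvPolynomial_isHomogeneous _ i)
    (fun i => MvPolynomial.isHomogeneous_X _ i) fun v hv => ?_
  simp only [Set.mem_ofPred_eq, Projectivization.smul_mk, Ne, MvPolynomial.eval_X,
    Projectivization.mk_eq_mk_iff_crossProduct_eq_zero _ hv, toMvPolynomial_eval_eq_apply]
  rfl

open Polynomial in
theorem continuous_line (P Q : ℂ[X]) : Continuous fun a : CofiniteTopology ℂ =>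
    line (P.eval (CofiniteTopology.of.symm a)) (Q.eval (CofiniteTopology.of.symm a)) := by
  rw [continuous_generateFrom_iff]
  rintro _ ⟨d, F, hF, rfl⟩
  have eval_restriction (a : ℂ) : (MvPolynomial.aeval ![P, Q, 1] F).eval a =
      MvPolynomial.eval ![P.eval a, Q.eval a, 1] F := by
    have aeval_comp : (Polynomial.aeval a).comp (MvPolynomial.aeval ![P, Q, 1]) =
        MvPolynomial.aeval (R := ℂ) ![P.eval a, Q.eval a, 1] :=
      MvPolynomial.algHom_ext fun i => by fin_cases i <;> simp
    rw [← MvPolynomial.coe_aeval_eq_eval, ← aeval_comp]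
    simp
  rw [CofiniteTopology.isOpen_iff]
  rintro ⟨a, ha⟩
  have restriction_ne_zero : MvPolynomial.aeval ![P, Q, 1] F ≠ 0 := fun h =>
    (mk_mem_nonvanishing hF _).mp ha (by rw [← eval_restriction, h, Polynomial.eval_zero])
  refine ((Polynomial.finite_setOfPred_isRoot restriction_ne_zero).preimage
    CofiniteTopology.of.symm.injective.injOn).subset fun a ha => ?_
  have := not_not.mp (mt (mk_mem_nonvanishing hF _).mpr ha)
  exact (eval_restriction _).trans this

end Zariski

theorem orbitOf_eq_iff {L L' : Line} : orbitOf L = orbitOf L' ↔ L ∈ MulAction.orbit G25 L' :=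
  Quotient.eq''

theorem continuous_orbitOf : Continuous orbitOf := continuous_quotient_mk'

theorem finite_setOf_orbitOf_eq (O : LineOrbit) : {L | orbitOf L = O}.Finite := by
  induction O using Quotient.inductionOn' with | h L =>
  exact (Set.finite_range fun g : G25 => g • L).subset fun L' h => orbitOf_eq_iff.mp h

instance t1Space_lineOrbit : T1Space LineOrbit where
  t1 O := isQuotientMap_quotient_mk'.isClosed_preimage.mp (finite_setOf_orbitOf_eq O).isClosed

section Generic

/-- The lines that have a nontrivial stabilizer in the image of `G25` in `PGL₃(ℂ)`. -/
def ramified : Set Line := {L | ∃ g : G25, g • L = L ∧ ∃ L' : Line, g • L' ≠ L'}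

theorem smul_mem_ramified {L : Line} (h : L ∈ ramified) (g : G25) : g • L ∈ ramified := by
  obtain ⟨k, hk, L', hL'⟩ := h
  refine ⟨g * k * g⁻¹, by rw [mul_smul, mul_smul, inv_smul_smul, hk], g • L', ?_⟩
  rwa [mul_smul, mul_smul, inv_smul_smul, (MulAction.injective g).ne_iff]

theorem mk_mem_ramified {v w : Fin 3 → ℂ} (hv : v ≠ 0) (hw : w ≠ 0)
    {A : Matrix (Fin 3) (Fin 3) ℂ} (hA : A ∈ hessianMonoid) (hAv : Fixes A v) (hAw : ¬Fixes A w) :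
    Projectivization.mk ℂ v hv ∈ ramified := by
  obtain ⟨g, hg, rfl⟩ := exists_mem_G25_coe_eq hA
  exact ⟨⟨g, hg⟩, (smul_mk_eq_mk_iff hv hv).mpr hAv, .mk ℂ w hw,
    mt (smul_mk_eq_mk_iff hw hw).mp hAw⟩

theorem line_coordinate_mem_ramified (x : ℂ) : line 0 x ∈ ramified := by
  have hw : ![(2 : ℂ), 1, 1] ≠ 0 := fun h => one_ne_zero (congrFun h 1)
  refine mk_mem_ramified _ hw (monomialMatrix_mem_hessianMonoid 1 0 1 0 0)
    (fixes_monomialMatrix_iff.mpr ⟨χ 1, ?_⟩) ?_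
  · simp [forall_fin_three, modThree_one]
  · rw [fixes_monomialMatrix_axis_iff two_ne_zero (by norm_num)]
    decide

theorem line_axis_mem_ramified (x : ℂ) : line x 1 ∈ ramified := by
  have hw : ![(0 : ℂ), 0, 1] ≠ 0 := fun h => one_ne_zero (congrFun h 2)
  refine mk_mem_ramified _ hw (monomialMatrix_mem_hessianMonoid (-1) 0 0 0 0)
    (fixes_monomialMatrix_iff.mpr ⟨1, ?_⟩) ?_
  · simp [forall_fin_three, modThree]
  · rw [fixes_monomialMatrix_vertex_iff]
    decide

theorem line_orderNine_mem_ramified {ν : ℂ} (hν : orderOf ν = 9) : line ν (ν ^ 2) ∈ ramified := by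
  have hw : ![(0 : ℂ), 0, 1] ≠ 0 := fun h => one_ne_zero (congrFun h 2)
  obtain ⟨r, -, hr⟩ := exists_χ_eq_pow_three hν
  refine mk_mem_ramified _ hw (monomialMatrix_mem_hessianMonoid 1 1 (-r) (-r) 0)
    ((fixes_monomialMatrix_orderNine_iff hν hr).mpr (by simp)) ?_
  rw [fixes_monomialMatrix_vertex_iff]
  decide

theorem isSpecialOrbit_iff {L : Line} : IsSpecialOrbit (orbitOf L) ↔ L ∈ ramified := by
  constructor
  · suffices h : ∀ O, IsSpecialOrbit O → ∃ L₀ ∈ ramified, orbitOf L₀ = O by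
      intro hL
      obtain ⟨L₀, h₀, h⟩ := h _ hL
      obtain ⟨g, rfl⟩ := orbitOf_eq_iff.mp h.symm
      exact smul_mem_ramified h₀ g
    rintro O (x | x | hν)
    exacts [⟨_, line_coordinate_mem_ramified x, rfl⟩, ⟨_, line_axis_mem_ramified x, rfl⟩,
      ⟨_, line_orderNine_mem_ramified hν, rfl⟩]
  · rintro ⟨⟨g, hg⟩, hgL, L', hgL'⟩
    induction L using Projectivization.ind with | h v hv =>
    induction L' using Projectivization.ind with | h w hw =>
    by_contra h
    obtain ⟨c, hc⟩ := eq_scalar_of_not_isSpecialOrbit h (coe_mem_hessianMonoid hg)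
      ((smul_mk_eq_mk_iff hv hv).mp hgL)
    exact hgL' ((smul_mk_eq_mk_iff hw hw).mpr ⟨χ c, hc ▸ scalar_mulVec c w⟩)

theorem isOpen_and_dense_compl_ramified : IsOpen ramifiedᶜ ∧ Dense ramifiedᶜ := by
  have compl_ramified : ramifiedᶜ =
      ⋂₀ ((fun g : G25 => {L : Line | g • L ≠ L}) '' {g | ∃ L' : Line, g • L' ≠ L'}) := by
    ext L
    simp only [ramified, Set.mem_compl_iff, Set.mem_ofPred_eq, not_exists, not_and',
      Set.sInter_image, Set.mem_iInter₂, forall_exists_index, Ne]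
  rw [compl_ramified]
  have finite := (Set.toFinite {g : G25 | ∃ L' : Line, g • L' ≠ L'}).image
    fun g : G25 => {L : Line | g • L ≠ L}
  have isOpen : ∀ U ∈ (fun g : G25 => {L : Line | g • L ≠ L}) '' {g | ∃ L' : Line, g • L' ≠ L'},
      IsOpen U := by
    rintro _ ⟨g, -, rfl⟩
    exact isOpen_setOf_smul_ne g
  refine ⟨finite.isOpen_sInter isOpen, finite.dense_sInter isOpen ?_⟩
  rintro _ ⟨g, hg, rfl⟩
  exact (isOpen_setOf_smul_ne g).dense hg

theorem isGeneric_orbitsOfType : IsGeneric (orbitsOfType 216 0 0) := by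
  have generic_iff (L : Line) : orbitOf L ∈ orbitsOfType 216 0 0 ↔ L ∈ ramifiedᶜ := by
    rw [Set.mem_compl_iff, ← isSpecialOrbit_iff]
    exact (mem_orbitsOfType_iff_orbitRow (n := 216) (r := 0) (p := 0)).trans
      ⟨fun h => by cases h with | generic h => exact h, .generic⟩
  have preimage_eq : orbitOf ⁻¹' orbitsOfType 216 0 0 = ramifiedᶜ := Set.ext generic_iff
  obtain ⟨isOpen, dense⟩ := isOpen_and_dense_compl_ramified
  refine ⟨isQuotientMap_quotient_mk'.isOpen_preimage.mp (preimage_eq ▸ isOpen), ?_⟩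
  refine (Quotient.mk''_surjective.denseRange.dense_image continuous_orbitOf dense).mono ?_
  rw [← preimage_eq]
  exact Set.image_preimage_subset _ _

end Generic

section OneParameterFamilies

theorem line_injective2 : Function.Injective2 line := by
  intro x x' y y' h
  obtain ⟨μ, hμ⟩ := (Projectivization.mk_eq_mk_iff' ..).mp h
  have hμ₁ : μ = 1 := by simpa using congrFun hμ 2
  subst hμ₁
  exact ⟨by simpa using congrFun hμ.symm 0, by simpa using congrFun hμ.symm 1⟩

open Polynomial in
theorem isInfiniteOfDimOne_image_orbitOf_line {P Q : ℂ[X]}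
    (hPQ : Function.Injective fun a => (P.eval a, Q.eval a)) {A : Set ℂ} (hA : A.Infinite) :
    IsInfiniteOfDimOne ((fun a => orbitOf (line (P.eval a) (Q.eval a))) '' A) := by
  have line_injective : Function.Injective fun a => line (P.eval a) (Q.eval a) := fun a b h =>
    hPQ (Prod.ext_iff.mpr (line_injective2 h))
  have finite_fiber (O : LineOrbit) : {a | orbitOf (line (P.eval a) (Q.eval a)) = O}.Finite :=
    (finite_setOf_orbitOf_eq O).preimage line_injective.injOn
  have infinite : ((fun a => orbitOf (line (P.eval a) (Q.eval a))) '' A).Infinite := fun h =>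
    hA <| (h.preimage' fun O _ => finite_fiber O).subset (Set.subset_preimage_image _ _)
  refine ⟨infinite, topologicalKrullDim_eq_one_of_subset_range
    (continuous_orbitOf.comp (continuous_line P Q)) ?_ infinite⟩
  rintro _ ⟨a, -, rfl⟩
  exact ⟨CofiniteTopology.of a, rfl⟩

theorem infinite_setOf_eval_ne_zero {R : Polynomial ℂ} (hR : R ≠ 0) :
    {a | R.eval a ≠ 0}.Infinite :=
  (Polynomial.finite_setOfPred_isRoot hR).infinite_compl

theorem orbitsOfType_coordinate :
    orbitsOfType 72 1 0 = (fun x => orbitOf (line 0 x)) '' {x | x ≠ 0 ∧ x ^ 6 ≠ 1} := by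
  ext O
  refine (mem_orbitsOfType_iff_orbitRow (n := 72) (r := 1) (p := 0)).trans ⟨fun h => ?_, ?_⟩
  · cases h with | coordinate hx₀ hx => exact ⟨_, ⟨hx₀, hx⟩, rfl⟩
  · rintro ⟨x, ⟨hx₀, hx⟩, rfl⟩
    exact .coordinate hx₀ hx

theorem orbitsOfType_axis :
    orbitsOfType 108 0 1 = (fun x => orbitOf (line x 1)) ''
      {x | x ≠ 0 ∧ x ^ 3 ≠ 1 ∧ x ^ 3 ≠ -8 ∧ x ^ 6 - 20 * x ^ 3 - 8 ≠ 0} := by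
  ext O
  refine (mem_orbitsOfType_iff_orbitRow (n := 108) (r := 0) (p := 1)).trans ⟨fun h => ?_, ?_⟩
  · cases h with | axis hx₀ hx₁ hx₂ hx₃ => exact ⟨_, ⟨hx₀, hx₁, hx₂, hx₃⟩, rfl⟩
  · rintro ⟨x, ⟨hx₀, hx₁, hx₂, hx₃⟩, rfl⟩
    exact .axis hx₀ hx₁ hx₂ hx₃

open Polynomial in
theorem isInfiniteOfDimOne_coordinate : IsInfiniteOfDimOne (orbitsOfType 72 1 0) := by
  have nonzero : (X * (X ^ 6 - 1) : ℂ[X]) ≠ 0 :=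
    mul_ne_zero X_ne_zero (X_pow_sub_C_ne_zero (by norm_num) 1)
  rw [orbitsOfType_coordinate]
  simpa [sub_eq_zero] using isInfiniteOfDimOne_image_orbitOf_line (P := 0) (Q := X)
    (fun a b h => by simpa using h) (infinite_setOf_eval_ne_zero nonzero)

open Polynomial in
theorem isInfiniteOfDimOne_axis : IsInfiniteOfDimOne (orbitsOfType 108 0 1) := by
  have nonzero : (X * ((X ^ 3 - 1) * ((X ^ 3 + C 8) * (X ^ 6 - 20 * X ^ 3 - 8))) : ℂ[X]) ≠ 0 := by
    have h : (X ^ 6 - 20 * X ^ 3 - 8 : ℂ[X]) ≠ 0 := fun h => by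
      simpa using congrArg (eval 0) h
    exact mul_ne_zero X_ne_zero (mul_ne_zero (X_pow_sub_C_ne_zero three_pos 1)
      (mul_ne_zero (X_pow_add_C_ne_zero three_pos 8) h))
  rw [orbitsOfType_axis]
  simpa [sub_eq_zero, add_eq_zero_iff_eq_neg] using isInfiniteOfDimOne_image_orbitOf_line
    (P := X) (Q := 1) (fun a b h => by simpa using h) (infinite_setOf_eval_ne_zero nonzero)

end OneParameterFamilies

theorem exists_orderOf_eq_nine : ∃ ν : ℂ, orderOf ν = 9 :=
  ⟨_, (Complex.isPrimitiveRoot_exp 9 (by norm_num)).eq_orderOf.symm⟩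

theorem numReflectionPlanes_eq_zero_iff {L : Line} :
    numReflectionPlanes L = 0 ↔ ∀ P, IsReflectionPlane P → ¬L.submodule ≤ P := by
  rw [numReflectionPlanes, Set.encard_eq_zero, Set.eq_empty_iff_forall_notMem]
  simp only [Set.mem_ofPred_eq, not_and]

theorem setOf_encard_eq_seventyTwo {ν : ℂ} (hν : orderOf ν = 9) :
    {O : LineOrbit | O.orbit.encard = 72 ∧
      ∀ L ∈ O.orbit, ∀ P, IsReflectionPlane P → ¬L.submodule ≤ P} =
    {orbitOf (line ν (ν ^ 2))} := by
  simp only [← numReflectionPlanes_eq_zero_iff]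
  refine Set.eq_singleton_iff_unique_mem.mpr ⟨?_, fun O ⟨hn, hr⟩ => ?_⟩
  · have h := (OrbitRow.orderNine hν).mem_orbitsOfType
    exact ⟨h.1, fun L hL => (h.2 L hL).1⟩
  · obtain ⟨n, r, p, h⟩ := exists_orbitRow O
    have hn' : (n : ℕ∞) = 72 := h.mem_orbitsOfType.1.symm.trans hn
    have hr' : (r : ℕ∞) = 0 := by
      obtain ⟨L, hL⟩ : O.orbit.Nonempty := Set.encard_ne_zero.mp (by rw [hn]; norm_num)
      exact (h.mem_orbitsOfType.2 L hL).1.symm.trans (hr L hL)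
    cases h with
    | orderNine hν' => exact orbitOf_line_orderNine hν' hν
    | _ => simp at hn' hr'

theorem setOf_encard_eq_fiftyFour : {O : LineOrbit | O.orbit.encard = 54} =
    {orbitOf (line ((1 + (√3 : ℝ)) * ω ^ 2) ω)} := by
  refine Set.eq_singleton_iff_unique_mem.mpr
    ⟨OrbitRow.sqrtThree.mem_orbitsOfType.1, fun O hO => ?_⟩
  obtain ⟨n, r, p, h⟩ := exists_orbitRow O
  have hn : (n : ℕ∞) = 54 := h.mem_orbitsOfType.1.symm.trans hO
  cases h with
  | sqrtThree => rfl
  | _ => norm_num at hn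

theorem OrbitRow.size_eq_iff {ν : ℂ} (hν : orderOf ν = 9) {n r p n' r' p' : ℕ} {O O' : LineOrbit}
    (h : OrbitRow n r p O) (h' : OrbitRow n' r' p' O')
    (h₁ : O ≠ orbitOf (line ν (ν ^ 2))) (h₂ : O ≠ orbitOf (line ((1 + (√3 : ℝ)) * ω ^ 2) ω))
    (h₁' : O' ≠ orbitOf (line ν (ν ^ 2))) (h₂' : O' ≠ orbitOf (line ((1 + (√3 : ℝ)) * ω ^ 2) ω)) :
    n = n' ↔ r = r' ∧ p = p' := by
  cases h with
  | orderNine hμ => exact absurd (orbitOf_line_orderNine hμ hν) h₁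
  | sqrtThree => exact absurd rfl h₂
  | _ =>
    cases h' with
    | orderNine hμ => exact absurd (orbitOf_line_orderNine hμ hν) h₁'
    | sqrtThree => exact absurd rfl h₂'
    | _ => decide

theorem encard_orbit_eq_iff {ν : ℂ} (hν : orderOf ν = 9) {L L' : Line}
    (h₁ : orbitOf L ≠ orbitOf (line ν (ν ^ 2)))
    (h₂ : orbitOf L ≠ orbitOf (line ((1 + (√3 : ℝ)) * ω ^ 2) ω))
    (h₁' : orbitOf L' ≠ orbitOf (line ν (ν ^ 2)))
    (h₂' : orbitOf L' ≠ orbitOf (line ((1 + (√3 : ℝ)) * ω ^ 2) ω)) :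
    (MulAction.orbit G25 L).encard = (MulAction.orbit G25 L').encard ↔
      numReflectionPlanes L = numReflectionPlanes L' ∧ numProperPlanes L = numProperPlanes L' := by
  obtain ⟨n, r, p, h⟩ := exists_orbitRow (orbitOf L)
  obtain ⟨n', r', p', h'⟩ := exists_orbitRow (orbitOf L')
  obtain ⟨hn, hr, hp⟩ := mem_orbitsOfType.mp h.mem_orbitsOfType
  obtain ⟨hn', hr', hp'⟩ := mem_orbitsOfType.mp h'.mem_orbitsOfType
  rw [hn, hr, hp, hn', hr', hp']
  exact_mod_cast h.size_eq_iff hν h' h₁ h₂ h₁' h₂'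

end Hessian

end

theorem mainTheorem4 :
    -- every orbit occurs in one of the eight rows of the table
    (∀ O : Hessian.LineOrbit,
      O ∈ Hessian.orbitsOfType 216 0 0 ∨ O ∈ Hessian.orbitsOfType 72 0 0 ∨
      O ∈ Hessian.orbitsOfType 108 0 1 ∨ O ∈ Hessian.orbitsOfType 54 0 1 ∨
      O ∈ Hessian.orbitsOfType 72 1 0 ∨ O ∈ Hessian.orbitsOfType 36 1 1 ∨
      O ∈ Hessian.orbitsOfType 12 2 3 ∨ O ∈ Hessian.orbitsOfType 9 4 0) ∧
    -- the number of orbits in each row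
    Hessian.IsGeneric (Hessian.orbitsOfType 216 0 0) ∧
    (Hessian.orbitsOfType 72 0 0).encard = 1 ∧
    Hessian.IsInfiniteOfDimOne (Hessian.orbitsOfType 108 0 1) ∧
    (Hessian.orbitsOfType 54 0 1).encard = 1 ∧
    Hessian.IsInfiniteOfDimOne (Hessian.orbitsOfType 72 1 0) ∧
    (Hessian.orbitsOfType 36 1 1).encard = 1 ∧
    (Hessian.orbitsOfType 12 2 3).encard = 1 ∧
    (Hessian.orbitsOfType 9 4 0).encard = 1 ∧
    -- the line `[ν : ν² : 1]` represents the only orbit of order 72 off the reflection planes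
    (∀ ν : ℂ, orderOf ν = 9 →
      {O : Hessian.LineOrbit | O.orbit.encard = 72 ∧
        ∀ L ∈ O.orbit, ∀ P, Hessian.IsReflectionPlane P → ¬ L.submodule ≤ P} =
      {Hessian.orbitOf (Hessian.line ν (ν ^ 2))}) ∧
    -- the line `[(1 + √3) ω² : ω : 1]` represents the only orbit of order 54
    {O : Hessian.LineOrbit | O.orbit.encard = 54} =
      {Hessian.orbitOf (Hessian.line ((1 + (Real.sqrt 3 : ℂ)) * Hessian.ω ^ 2) Hessian.ω)} ∧
    -- off these two orbits, the size of the orbit is characterized by the numbers of planes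
    (∀ ν : ℂ, orderOf ν = 9 → ∀ L L' : Hessian.Line,
      L ∉ MulAction.orbit Hessian.G25 (Hessian.line ν (ν ^ 2)) →
      L ∉ MulAction.orbit Hessian.G25
        (Hessian.line ((1 + (Real.sqrt 3 : ℂ)) * Hessian.ω ^ 2) Hessian.ω) →
      L' ∉ MulAction.orbit Hessian.G25 (Hessian.line ν (ν ^ 2)) →
      L' ∉ MulAction.orbit Hessian.G25
        (Hessian.line ((1 + (Real.sqrt 3 : ℂ)) * Hessian.ω ^ 2) Hessian.ω) →
      ((MulAction.orbit Hessian.G25 L).encard = (MulAction.orbit Hessian.G25 L').encard ↔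
        Hessian.numReflectionPlanes L = Hessian.numReflectionPlanes L' ∧
        Hessian.numProperPlanes L = Hessian.numProperPlanes L')) := by
  obtain ⟨μ, hμ⟩ := Hessian.exists_orderOf_eq_nine
  refine ⟨fun O => ?_, Hessian.isGeneric_orbitsOfType,
    Hessian.encard_orbitsOfType_eq_one (.orderNine hμ) ?_, Hessian.isInfiniteOfDimOne_axis,
    Hessian.encard_orbitsOfType_eq_one .sqrtThree ?_, Hessian.isInfiniteOfDimOne_coordinate,
    Hessian.encard_orbitsOfType_eq_one .mirrorCenter ?_,
    Hessian.encard_orbitsOfType_eq_one .vertex ?_, Hessian.encard_orbitsOfType_eq_one .center ?_,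
    fun ν hν => Hessian.setOf_encard_eq_seventyTwo hν, Hessian.setOf_encard_eq_fiftyFour,
    fun ν hν L L' h₁ h₂ h₁' h₂' => ?_⟩
  · obtain ⟨n, r, p, h⟩ := Hessian.exists_orbitRow O
    have hO := h.mem_orbitsOfType
    cases h <;> tauto
  · rintro _ (_ | hν)
    exact Hessian.orbitOf_line_orderNine hν hμ
  iterate 4 · rintro _ ⟨⟩; rfl
  · rw [← Hessian.orbitOf_eq_iff] at h₁ h₂ h₁' h₂'
    exact Hessian.encard_orbit_eq_iff hν h₁ h₂ h₁' h₂'
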